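/- All $2$-categories and $2$-functors are strict, $\mathcal B^{\mathrm{op}}$ reverses $1$-cells only, and $1$ denotes the terminal category. Let $\mathcal A,\mathcal B$ be $2$-categories, $\mathcal A$ with hom-categories in $\mathbf{Cat}$, and let $K\colon\mathcal B\to\mathcal A$ be a split discrete $2$-opfibration: the underlying functor of $K$ is a Grothendieck opfibration equipped with a choice of cocartesian lifts that is closed under identities and composition, and every functor $K_{B,B'}\colon\mathcal B(B,B')\to\mathcal A(K(B),K(B'))$ is a discrete fibration. Let $F\colon\mathcal B^{\mathrm{op}}\times\mathcal A\to\mathbf{Cat}$ be a $2$-functor. An oplax$^{\mathrm{cart}}$-lax natural transformation $\alpha\colon G\to H$ between $2$-functors $G,H\colon\mathcal B^{\mathrm{op}}\times\mathcal C\to\mathcal E$ consists of $1$-cells $\alpha_{B,C}\colon G(B,C)\to H(B,C)$, of $2$-cells $$\alpha_{f,C}\colon \alpha_{B,C}\circ G(f,\mathrm{id})\Rightarrow H(f,\mathrm{id})\circ\alpha_{B',C}\qquad (f\colon B\to B'\text{ in }\mathcal B)$$ making $\alpha_{-,C}$ oplax natural in $\mathcal B^{\mathrm{op}}$ and such that $\alpha_{f,C}$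 is an identity whenever $f$ is one of the chosen cocartesian lifts, and of $2$-cells $$\alpha_{B,g}\colon H(\mathrm{id},g)\circ\alpha_{B,C}\Rightarrow\alpha_{B,C'}\circ G(\mathrm{id},g)\qquad (g\colon C\to C'\text{ in }\mathcal C)$$ making $\alpha_{B,-}$ lax natural in $\mathcal C$, subject to the compatibility axiom $$(\alpha_{f,C'}\ast G(\mathrm{id},g))\cdot(\alpha_{B,g}\ast G(f,\mathrm{id}))=(H(f,\mathrm{id})\ast\alpha_{B',g})\cdot(H(\mathrm{id},g)\ast\alpha_{f,C}).$$ A modification $\Theta\colon\alpha\to\beta$ is a family of $2$-cells $\Theta_{B,C}\colon\alpha_{B,C}\Rightarrow\beta_{B,C}$ that is a modification in $B$ for fixed $C$ and in $C$ for fixed $B$. An extraordinary lax natural transformation $\eta\colon 1\to F(B,K(B))$ consists of functors $\eta_B\colon 1\to F(B,K(B))$ and, for $f\colon B\to B'$ in $\mathcal B$, natural transformations $$\eta_f\colon F(\mathrm{id},K(f))\circ\eta_B\Rightarrow F(f,\mathrm{id})\circ\eta_{B'}$$ such that $\eta_{\mathrm{id}_B}$ is the identity, $$\eta_{f'f}=(F(f,\mathrm{id})\ast\eta_{f'})\cdot(F(\mathrm{id},K(f'))\ast\eta_f)\quad\text{for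 } B\xrightarrow{f}B'\xrightarrow{f'}B'',$$ and $$(F(\delta,\mathrm{id})\ast\eta_{B'})\cdot\eta_f=\eta_{f'}\cdot(F(\mathrm{id},K(\delta))\ast\eta_B)\quad\text{for every $2$-cell } \delta\colon f\Rightarrow f'\colon B\to B'.$$ A modification $\Gamma\colon\eta\to\theta$ is a family of natural transformations $\Gamma_B\colon\eta_B\Rightarrow\theta_B$ with $\theta_f\cdot(F(\mathrm{id},K(f))\ast\Gamma_B)=(F(f,\mathrm{id})\ast\Gamma_{B'})\cdot\eta_f$ for all $f\colon B\to B'$. Theorem (the oplax$^{\mathrm{cart}}$-lax parametrized Yoneda lemma). There is an isomorphism of categories, and in particular a bijection on objects, between the category of oplax$^{\mathrm{cart}}$-lax natural transformations $$\alpha_{B,A}\colon\mathcal A(K(B),A)\to F(B,A)\qquad\text{in }(B,A)\in\mathcal B^{\mathrm{op}}\times\mathcal A$$ and their modifications, and the category of extraordinary lax natural transformations $$\eta_B\colon 1\to F(B,K(B))\qquad\text{in }B\in\mathcal B$$ and their modifications. It is given by evaluation at identities: $\alpha$ corresponds to the $\eta$ with components $$\eta_B=\bigl(1\xrightarrow{\mathrm{id}_{K(B)}}\mathcal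 A(K(B),K(B))\xrightarrow{\alpha_{B,K(B)}}F(B,K(B))\bigr)$$ and structure $2$-cells $\eta_f=(\alpha_{f,K(B')})_{\mathrm{id}_{K(B')}}\cdot(\alpha_{B,K(f)})_{\mathrm{id}_{K(B)}}$ for $f\colon B\to B'$, and a modification $\Theta$ corresponds to the $\Gamma$ with $\Gamma_B=(\Theta_{B,K(B)})_{\mathrm{id}_{K(B)}}$. -/

import Mathlib

open CategoryTheory Bicategory Opposite
open scoped CategoryTheory.Prod

universe w w₁ w₂ w₃ v v₁ v₂ v₃ u u₁ u₂ u₃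

set_option linter.unusedSectionVars false

namespace OplaxCartLax

lemma eqToHom_op2 {B : Type u₁} [Bicategory.{w₁, v₁} B] {a b : Bᵒᵖ} {f g : a ⟶ b} (h : f = g) :
    (eqToHom h : f ⟶ g) = Bicategory.Opposite.op2 (eqToHom (congrArg Quiver.Hom.unop h)) := by
  subst h
  rfl

/-- The 1-cell dual of a (strict) 2-category is a (strict) 2-category. -/
instance strictOp {B : Type u₁} [Bicategory.{w₁, v₁} B] [Strict B] : Strict Bᵒᵖ where
  id_comp f := Quiver.Hom.unop_inj (Strict.comp_id f.unop)
  comp_id f := Quiver.Hom.unop_inj (Strict.id_comp f.unop)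
  assoc f g h := Quiver.Hom.unop_inj (Strict.assoc h.unop g.unop f.unop).symm
  leftUnitor_eqToIso f := by
    ext
    rw [eqToIso.hom, eqToHom_op2]
    change Bicategory.Opposite.op2 (ρ_ f.unop).hom = _
    rw [Strict.rightUnitor_eqToIso]
    rfl
  rightUnitor_eqToIso f := by
    ext
    rw [eqToIso.hom, eqToHom_op2]
    change Bicategory.Opposite.op2 (λ_ f.unop).hom = _
    rw [Strict.leftUnitor_eqToIso]
    rfl
  associator_eqToIso f g h := by
    ext
    rw [eqToIso.hom, eqToHom_op2]
    change Bicategory.Opposite.op2 (α_ h.unop g.unop f.unop).inv = _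
    rw [Strict.associator_eqToIso]
    rfl

/-! ### Split discrete 2-opfibrations -/

section Fibrations

variable {X : Type u₁} [Category.{v₁} X] {S : Type u₂} [Category.{v₂} S]

/-- A functor is a discrete fibration if every morphism `u : s ⟶ P x` has a unique lift with
codomain `x`. -/
def IsDiscreteFibration (P : X ⥤ S) : Prop :=
  ∀ (x : X) {s : S} (u : s ⟶ P.obj x), ∃! p : (Σ y : X, y ⟶ x), P.IsHomLift u p.2

/-- A split cleavage of a Grothendieck opfibration `P`: a choice of (strongly) cocartesian lifts
`lift x u : x ⟶ cod x u` of all morphisms `u : P x ⟶ s` that is strictly compatible with identities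
and composition. Morphisms with source `x` are compared together with their target. -/
structure SplitCleavage (P : X ⥤ S) where
  cod (x : X) {s : S} (u : P.obj x ⟶ s) : X
  lift (x : X) {s : S} (u : P.obj x ⟶ s) : x ⟶ cod x u
  isStronglyCocartesian (x : X) {s : S} (u : P.obj x ⟶ s) :
    P.IsStronglyCocartesian u (lift x u)
  lift_id (x : X) :
    (⟨cod x (𝟙 (P.obj x)), lift x (𝟙 (P.obj x))⟩ : Σ y : X, x ⟶ y) = ⟨x, 𝟙 x⟩
  lift_comp (x : X) {s t : S} (u : P.obj x ⟶ s) (v : P.obj (cod x u) ⟶ t) :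
    (⟨cod x (P.map (lift x u) ≫ v), lift x (P.map (lift x u) ≫ v)⟩ : Σ y : X, x ⟶ y) =
      ⟨cod (cod x u) v, lift x u ≫ lift (cod x u) v⟩

/-- The marked morphisms: those that are one of the chosen cocartesian lifts. -/
def SplitCleavage.IsChosen {P : X ⥤ S} (σ : SplitCleavage P) {x y : X} (f : x ⟶ y) : Prop :=
  (⟨y, f⟩ : Σ z : X, x ⟶ z) = ⟨σ.cod x (P.map f), σ.lift x (P.map f)⟩

end Fibrations

lemma whiskers_naturality {A : Type u} [Bicategory.{w, v} A] {a a' b b' : A} {f f' : a' ⟶ a} {g g' : b ⟶ b'} (δ : f ⟶ f')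
    (γ : g ⟶ g') {h k : a ⟶ b} (θ : h ⟶ k) :
    (f ◁ θ) ▷ g ≫ (δ ▷ k) ▷ g ≫ (f' ≫ k) ◁ γ =
      ((δ ▷ h) ▷ g ≫ (f' ≫ h) ◁ γ) ≫ (f' ◁ θ) ▷ g' := by
  rw [Category.assoc, whisker_exchange, ← comp_whiskerRight_assoc, ← comp_whiskerRight_assoc,
    whisker_exchange]

lemma whiskers_comp {A : Type u} [Bicategory.{w, v} A] {a a' b b' : A} {f f' f'' : a' ⟶ a} {g g' g'' : b ⟶ b'} (δ : f ⟶ f')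
    (δ' : f' ⟶ f'') (γ : g ⟶ g') (γ' : g' ⟶ g'') (h : a ⟶ b) :
    ((δ ≫ δ') ▷ h) ▷ g ≫ (f'' ≫ h) ◁ (γ ≫ γ') =
      ((δ ▷ h) ▷ g ≫ (f' ≫ h) ◁ γ) ≫ (δ' ▷ h) ▷ g' ≫ (f'' ≫ h) ◁ γ' := by
  rw [comp_whiskerRight, comp_whiskerRight, whiskerLeft_comp, Category.assoc, Category.assoc,
    whisker_exchange_assoc]

lemma whiskers_id {A : Type u} [Bicategory.{w, v} A] {a a' b b' : A} (f : a' ⟶ a) (g : b ⟶ b')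
    (h : a ⟶ b) : (𝟙 f ▷ h) ▷ g ≫ (f ≫ h) ◁ 𝟙 g = 𝟙 ((f ≫ h) ≫ g) := by
  simp

variable {A : Type u} [Bicategory.{w, v} A] [Strict A]
  {B : Type u₁} [Bicategory.{w₁, v₁} B] [Strict B]
  {C : Type u₂} [Bicategory.{w₂, v₂} C] [Strict C]
  {E : Type u₃} [Bicategory.{w₃, v₃} E] [Strict E]

/-- The structure of a split discrete 2-opfibration on a 2-functor `K : B ⥤ A`: the underlying
functor is a split Grothendieck opfibration, and all functors `B(b, b') ⥤ A(K b, K b')` are discrete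
fibrations. -/
structure SplitDiscreteTwoOpfibration (K : StrictPseudofunctor B A) where
  cleavage : SplitCleavage K.toFunctor
  isDiscreteFibration (b b' : B) : IsDiscreteFibration (K.mapFunctor b b')

/-! ### 2-functors of two variables -/

section TwoVariables

variable (G : StrictPseudofunctor (Bᵒᵖ × C) E)

/-- `G(f, id) : G(b', c) ⟶ G(b, c)` for `f : b ⟶ b'` in `B`. -/
def mapL {b b' : B} (f : b ⟶ b') (c : C) : G.obj (op b', c) ⟶ G.obj (op b, c) :=
  G.map (X := (op b', c)) (Y := (op b, c)) (f.op ×ₘ 𝟙 c)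

/-- `G(id, g) : G(b, c) ⟶ G(b, c')` for `g : c ⟶ c'` in `C`. -/
def mapR (b : B) {c c' : C} (g : c ⟶ c') : G.obj (op b, c) ⟶ G.obj (op b, c') :=
  G.map (X := (op b, c)) (Y := (op b, c')) (𝟙 (op b) ×ₘ g)

/-- `G(δ, id)` for a 2-cell `δ : f ⟶ f'` in `B`. -/
def map₂L {b b' : B} {f f' : b ⟶ b'} (δ : f ⟶ f') (c : C) : mapL G f c ⟶ mapL G f' c :=
  G.map₂ (a := (op b', c)) (b := (op b, c)) (Bicategory.Opposite.op2 δ ×ₘ 𝟙 (𝟙 c))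

/-- `G(id, δ)` for a 2-cell `δ : g ⟶ g'` in `C`. -/
def map₂R (b : B) {c c' : C} {g g' : c ⟶ c'} (δ : g ⟶ g') : mapR G b g ⟶ mapR G b g' :=
  G.map₂ (a := (op b, c)) (b := (op b, c')) (𝟙 (𝟙 (op b)) ×ₘ δ)

lemma mapL_id (b : B) (c : C) : mapL G (𝟙 b) c = 𝟙 (G.obj (op b, c)) :=
  G.map_id (op b, c)

lemma mapR_id (b : B) (c : C) : mapR G b (𝟙 c) = 𝟙 (G.obj (op b, c)) :=
  G.map_id (op b, c)

lemma mapL_comp {b b' b'' : B} (f : b ⟶ b') (f' : b' ⟶ b'') (c : C) :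
    mapL G (f ≫ f') c = mapL G f' c ≫ mapL G f c := by
  refine Eq.trans ?_ (G.map_comp (a := (op b'', c)) (b := (op b', c)) (c := (op b, c)) _ _)
  exact congrArg G.map (Prod.ext rfl (Strict.id_comp _).symm)

lemma mapR_comp (b : B) {c c' c'' : C} (g : c ⟶ c') (g' : c' ⟶ c'') :
    mapR G b (g ≫ g') = mapR G b g ≫ mapR G b g' := by
  refine Eq.trans ?_ (G.map_comp (a := (op b, c)) (b := (op b, c')) (c := (op b, c'')) _ _)
  exact congrArg G.map (Prod.ext (Strict.id_comp _).symm rfl)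

lemma mapL_mapR {b b' : B} (f : b ⟶ b') {c c' : C} (g : c ⟶ c') :
    mapL G f c ≫ mapR G b g = mapR G b' g ≫ mapL G f c' := by
  refine (G.map_comp (a := (op b', c)) (b := (op b, c)) (c := (op b, c')) _ _).symm.trans
    (Eq.trans ?_ (G.map_comp (a := (op b', c)) (b := (op b', c')) (c := (op b, c')) _ _))
  exact congrArg G.map (Prod.ext ((Strict.comp_id _).trans (Strict.id_comp _).symm)
    ((Strict.id_comp _).trans (Strict.comp_id _).symm))

end TwoVariables

/-! ### Oplax-cart-lax natural transformations -/

/-- Oplax-cart-lax natural transformations between 2-functors `G, H : Bᵒᵖ × C ⥤ E`, where `B` carries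
the cartesian marking given by a split discrete 2-opfibration `K : B ⥤ A`. Every `eqToHom` below is
an identity 2-cell expressing strict functoriality. -/
@[ext]
structure OplaxCartLaxTrans {K : StrictPseudofunctor B A} (σ : SplitDiscreteTwoOpfibration K)
    (G H : StrictPseudofunctor (Bᵒᵖ × C) E) where
  app (b : B) (c : C) : G.obj (op b, c) ⟶ H.obj (op b, c)
  /-- the structure 2-cell at a morphism of `Bᵒᵖ` -/
  oplaxCell {b b' : B} (f : b ⟶ b') (c : C) :
    mapL G f c ≫ app b c ⟶ app b' c ≫ mapL H f c
  /-- the structure 2-cell at a morphism of `C` -/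
  laxCell (b : B) {c c' : C} (g : c ⟶ c') :
    app b c ≫ mapR H b g ⟶ mapR G b g ≫ app b c'
  oplaxCell_naturality {b b' : B} {f f' : b ⟶ b'} (δ : f ⟶ f') (c : C) :
    map₂L G δ c ▷ app b c ≫ oplaxCell f' c = oplaxCell f c ≫ app b' c ◁ map₂L H δ c
  oplaxCell_id (b : B) (c : C) :
    oplaxCell (𝟙 b) c ≫ app b c ◁ eqToHom (mapL_id H b c) =
      eqToHom (mapL_id G b c) ▷ app b c ≫ (λ_ (app b c)).hom ≫ (ρ_ (app b c)).inv
  oplaxCell_comp {b b' b'' : B} (f : b ⟶ b') (f' : b' ⟶ b'') (c : C) :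
    oplaxCell (f ≫ f') c ≫ app b'' c ◁ eqToHom (mapL_comp H f f' c) =
      eqToHom (mapL_comp G f f' c) ▷ app b c ≫ (α_ _ _ _).hom ≫
        mapL G f' c ◁ oplaxCell f c ≫ (α_ _ _ _).inv ≫
          oplaxCell f' c ▷ mapL H f c ≫ (α_ _ _ _).hom
  /-- cartesian-marked: the structure 2-cells at the chosen cocartesian lifts are identities -/
  oplaxCell_marked {b b' : B} (f : b ⟶ b') (_ : σ.cleavage.IsChosen f) (c : C) :
    ∃ h : mapL G f c ≫ app b c = app b' c ≫ mapL H f c, oplaxCell f c = eqToHom h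
  laxCell_naturality (b : B) {c c' : C} {g g' : c ⟶ c'} (δ : g ⟶ g') :
    laxCell b g ≫ map₂R G b δ ▷ app b c' = app b c ◁ map₂R H b δ ≫ laxCell b g'
  laxCell_id (b : B) (c : C) :
    laxCell b (𝟙 c) ≫ eqToHom (mapR_id G b c) ▷ app b c =
      app b c ◁ eqToHom (mapR_id H b c) ≫ (ρ_ (app b c)).hom ≫ (λ_ (app b c)).inv
  laxCell_comp (b : B) {c c' c'' : C} (g : c ⟶ c') (g' : c' ⟶ c'') :
    laxCell b (g ≫ g') ≫ eqToHom (mapR_comp G b g g') ▷ app b c'' =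
      app b c ◁ eqToHom (mapR_comp H b g g') ≫ (α_ _ _ _).inv ≫
        laxCell b g ▷ mapR H b g' ≫ (α_ _ _ _).hom ≫
          mapR G b g ◁ laxCell b g' ≫ (α_ _ _ _).inv
  compatibility {b b' : B} (f : b ⟶ b') {c c' : C} (g : c ⟶ c') :
    mapL G f c ◁ laxCell b g ≫ (α_ _ _ _).inv ≫ eqToHom (mapL_mapR G f g) ▷ app b c' ≫
        (α_ _ _ _).hom ≫ mapR G b' g ◁ oplaxCell f c' =
      (α_ _ _ _).inv ≫ oplaxCell f c ▷ mapR H b g ≫ (α_ _ _ _).hom ≫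
        app b' c ◁ eqToHom (mapL_mapR H f g) ≫ (α_ _ _ _).inv ≫
          laxCell b' g ▷ mapL H f c' ≫ (α_ _ _ _).hom

namespace OplaxCartLaxTrans

variable {K : StrictPseudofunctor B A} {σ : SplitDiscreteTwoOpfibration K}
  {G H : StrictPseudofunctor (Bᵒᵖ × C) E}

/-- Modifications between oplax-cart-lax natural transformations. -/
@[ext]
structure Modification (α β : OplaxCartLaxTrans σ G H) where
  app (b : B) (c : C) : α.app b c ⟶ β.app b c
  oplax {b b' : B} (f : b ⟶ b') (c : C) :
    mapL G f c ◁ app b c ≫ β.oplaxCell f c = α.oplaxCell f c ≫ app b' c ▷ mapL H f c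
  lax (b : B) {c c' : C} (g : c ⟶ c') :
    app b c ▷ mapR H b g ≫ β.laxCell b g = α.laxCell b g ≫ mapR G b g ◁ app b c'

/-- Oplax-cart-lax natural transformations and modifications form a category, under componentwise
(vertical) composition. -/
instance : Category (OplaxCartLaxTrans σ G H) where
  Hom := Modification
  id α :=
    { app := fun b c => 𝟙 (α.app b c)
      oplax := by simp
      lax := by simp }
  comp Θ Ω :=
    { app := fun b c => Θ.app b c ≫ Ω.app b c
      oplax := by
        intro b b' f c
        rw [whiskerLeft_comp, Category.assoc, Ω.oplax, ← Category.assoc, Θ.oplax, Category.assoc,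
          comp_whiskerRight]
      lax := by
        intro b c c' g
        rw [comp_whiskerRight, Category.assoc, Ω.lax, ← Category.assoc, Θ.lax, Category.assoc,
          whiskerLeft_comp] }

end OplaxCartLaxTrans

/-! ### Extraordinary lax natural transformations -/

/-- The data of an extraordinary lax natural transformation `X ⟶ T(b, K b)` in `b : B`, for an object
`X` of a 2-category `E`, a 2-functor `T : Bᵒᵖ × C ⥤ E` and a 2-functor `K : B ⥤ C`. -/
@[ext]
structure ExtraordinaryLaxData (K : StrictPseudofunctor B C) (X : E)
    (T : StrictPseudofunctor (Bᵒᵖ × C) E) where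
  app (b : B) : X ⟶ T.obj (op b, K.obj b)
  cell {b b' : B} (f : b ⟶ b') :
    app b ≫ mapR T b (K.map f) ⟶ app b' ≫ mapL T f (K.obj b')

/-- Extraordinary lax natural transformations `X ⟶ T(b, K b)` in `b : B`. -/
@[ext]
structure ExtraordinaryLaxTrans (K : StrictPseudofunctor B C) (X : E)
    (T : StrictPseudofunctor (Bᵒᵖ × C) E) extends ExtraordinaryLaxData K X T where
  cell_naturality {b b' : B} {f f' : b ⟶ b'} (δ : f ⟶ f') :
    cell f ≫ app b' ◁ map₂L T δ (K.obj b') = app b ◁ map₂R T b (K.map₂ δ) ≫ cell f'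
  cell_id (b : B) :
    cell (𝟙 b) = app b ◁ eqToHom (by rw [K.map_id, mapR_id, mapL_id])
  cell_comp {b b' b'' : B} (f : b ⟶ b') (f' : b' ⟶ b'') :
    cell (f ≫ f') =
      app b ◁ eqToHom (by rw [K.map_comp, mapR_comp]) ≫ (α_ _ _ _).inv ≫
        cell f ▷ mapR T b (K.map f') ≫ (α_ _ _ _).hom ≫
          app b' ◁ eqToHom (mapL_mapR T f (K.map f')) ≫ (α_ _ _ _).inv ≫
            cell f' ▷ mapL T f (K.obj b'') ≫ (α_ _ _ _).hom ≫
              app b'' ◁ eqToHom (mapL_comp T f f' (K.obj b'')).symm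

namespace ExtraordinaryLaxTrans

variable {K : StrictPseudofunctor B C} {X : E} {T : StrictPseudofunctor (Bᵒᵖ × C) E}

/-- Modifications between extraordinary lax natural transformations. -/
@[ext]
structure Modification (η θ : ExtraordinaryLaxTrans K X T) where
  app (b : B) : η.app b ⟶ θ.app b
  naturality {b b' : B} (f : b ⟶ b') :
    app b ▷ mapR T b (K.map f) ≫ θ.cell f = η.cell f ≫ app b' ▷ mapL T f (K.obj b')

/-- Extraordinary lax natural transformations and modifications form a category, under componentwise
(vertical) composition. -/
instance : Category (ExtraordinaryLaxTrans K X T) where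
  Hom := Modification
  id η :=
    { app := fun b => 𝟙 (η.app b)
      naturality := by simp }
  comp Γ Ω :=
    { app := fun b => Γ.app b ≫ Ω.app b
      naturality := by
        intro b b' f
        rw [comp_whiskerRight, Category.assoc, Ω.naturality, ← Category.assoc, Γ.naturality,
          Category.assoc, comp_whiskerRight] }

end ExtraordinaryLaxTrans

/-! ### The 2-functor `A(K(-), -)` and evaluation at identities -/

section HomTwoFunctor

/-- The functor `A(a, b) ⥤ A(a', b')` given by composing with `f : a' ⟶ a` and `g : b ⟶ b'`. -/
def homMap {a a' b b' : A} (f : a' ⟶ a) (g : b ⟶ b') : (a ⟶ b) ⥤ (a' ⟶ b') where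
  obj h := (f ≫ h) ≫ g
  map θ := (f ◁ θ) ▷ g

/-- The natural transformation between composition functors given by whiskering with 2-cells. -/
def homMap₂ {a a' b b' : A} {f f' : a' ⟶ a} {g g' : b ⟶ b'} (δ : f ⟶ f') (γ : g ⟶ g') :
    homMap f g ⟶ homMap f' g' where
  app h := (δ ▷ h) ▷ g ≫ (f' ≫ h) ◁ γ
  naturality _ _ θ := whiskers_naturality δ γ θ

lemma homMap_id (a b : A) : homMap (𝟙 a) (𝟙 b) = 𝟭 (a ⟶ b) := by
  refine CategoryTheory.Functor.ext
    (fun h => (Strict.comp_id _).trans (Strict.id_comp h)) (fun h k θ => ?_)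
  change (𝟙 a ◁ θ) ▷ 𝟙 b = eqToHom ((Strict.comp_id _).trans (Strict.id_comp h)) ≫ θ ≫
    eqToHom ((Strict.comp_id _).trans (Strict.id_comp k)).symm
  simp [Strict.leftUnitor_eqToIso, Strict.rightUnitor_eqToIso]

lemma whiskers_map_comp {a a' a'' b b' b'' : A} (f : a' ⟶ a) (f' : a'' ⟶ a') (g : b ⟶ b')
    (g' : b' ⟶ b'') (h : a ⟶ b) :
    ((f' ≫ f) ≫ h) ≫ g ≫ g' = (f' ≫ (f ≫ h) ≫ g) ≫ g' := by
  simp only [Strict.assoc]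

lemma homMap_comp {a a' a'' b b' b'' : A} (f : a' ⟶ a) (f' : a'' ⟶ a') (g : b ⟶ b')
    (g' : b' ⟶ b'') : homMap (f' ≫ f) (g ≫ g') = homMap f g ⋙ homMap f' g' := by
  refine CategoryTheory.Functor.ext (fun h => whiskers_map_comp f f' g g' h) (fun h k θ => ?_)
  change ((f' ≫ f) ◁ θ) ▷ (g ≫ g') = eqToHom (whiskers_map_comp f f' g g' h) ≫
    (f' ◁ (f ◁ θ) ▷ g) ▷ g' ≫ eqToHom (whiskers_map_comp f f' g g' k).symm
  simp [Strict.associator_eqToIso]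

lemma whiskers_left {a a' a'' b b' b'' : A} (f : a' ⟶ a) {f' f'' : a'' ⟶ a'} (δ : f' ⟶ f'')
    (g : b ⟶ b') {g' g'' : b' ⟶ b''} (γ : g' ⟶ g'') (h : a ⟶ b) :
    ((δ ▷ f) ▷ h) ▷ (g ≫ g') ≫ ((f'' ≫ f) ≫ h) ◁ (g ◁ γ) =
      eqToHom (whiskers_map_comp f f' g g' h) ≫
        ((δ ▷ ((f ≫ h) ≫ g)) ▷ g' ≫ (f'' ≫ (f ≫ h) ≫ g) ◁ γ) ≫
          eqToHom (whiskers_map_comp f f'' g g'' h).symm := by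
  simp [Strict.associator_eqToIso]

lemma whiskers_right {a a' a'' b b' b'' : A} {f f'' : a' ⟶ a} (δ : f ⟶ f'') (f' : a'' ⟶ a')
    {g g'' : b ⟶ b'} (γ : g ⟶ g'') (g' : b' ⟶ b'') (h : a ⟶ b) :
    ((f' ◁ δ) ▷ h) ▷ (g ≫ g') ≫ ((f' ≫ f'') ≫ h) ◁ (γ ▷ g') =
      eqToHom (whiskers_map_comp f f' g g' h) ≫
        ((f' ◁ ((δ ▷ h) ▷ g ≫ (f'' ≫ h) ◁ γ)) ▷ g') ≫
          eqToHom (whiskers_map_comp f'' f' g'' g' h).symm := by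
  simp [Strict.associator_eqToIso]

lemma homMap₂_left {a a' a'' b b' b'' : A} (f : a' ⟶ a) {f' f'' : a'' ⟶ a'} (δ : f' ⟶ f'')
    (g : b ⟶ b') {g' g'' : b' ⟶ b''} (γ : g' ⟶ g'') {k k' : a'' ⟶ a} (e : k = f' ≫ f)
    (e' : k' = f'' ≫ f) :
    homMap₂ (eqToHom e ≫ δ ▷ f ≫ eqToHom e'.symm) (g ◁ γ) =
      eqToHom (by rw [e, homMap_comp]) ≫
        CategoryTheory.Functor.whiskerLeft (homMap f g) (homMap₂ δ γ) ≫
          eqToHom (by rw [e', homMap_comp]) := by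
  subst e e'
  ext h
  rw [eqToHom_refl, eqToHom_refl, Category.id_comp, Category.comp_id, NatTrans.comp_app,
    NatTrans.comp_app, eqToHom_app, eqToHom_app]
  exact whiskers_left f δ g γ h

lemma homMap₂_right {a a' a'' b b' b'' : A} {f f'' : a' ⟶ a} (δ : f ⟶ f'') (f' : a'' ⟶ a')
    {g g'' : b ⟶ b'} (γ : g ⟶ g'') (g' : b' ⟶ b'') {k k' : a'' ⟶ a} (e : k = f' ≫ f)
    (e' : k' = f' ≫ f'') :
    homMap₂ (eqToHom e ≫ f' ◁ δ ≫ eqToHom e'.symm) (γ ▷ g') =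
      eqToHom (by rw [e, homMap_comp]) ≫
        CategoryTheory.Functor.whiskerRight (homMap₂ δ γ) (homMap f' g') ≫
          eqToHom (by rw [e', homMap_comp]) := by
  subst e e'
  ext h
  rw [eqToHom_refl, eqToHom_refl, Category.id_comp, Category.comp_id, NatTrans.comp_app,
    NatTrans.comp_app, eqToHom_app, eqToHom_app]
  exact whiskers_right δ f' γ g' h

lemma strict_map₂_whiskerRight (K : StrictPseudofunctor B A) {a b c : B} {f f' : a ⟶ b}
    (δ : f ⟶ f') (g : b ⟶ c) :
    K.map₂ (δ ▷ g) =
      eqToHom (K.map_comp f g) ≫ K.map₂ δ ▷ K.map g ≫ eqToHom (K.map_comp f' g).symm := by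
  rw [K.map₂_whisker_right, K.mapComp_eq_eqToIso, K.mapComp_eq_eqToIso]
  rfl

lemma strict_map₂_whiskerLeft (K : StrictPseudofunctor B A) {a b c : B} (f : a ⟶ b)
    {g g' : b ⟶ c} (δ : g ⟶ g') :
    K.map₂ (f ◁ δ) =
      eqToHom (K.map_comp f g) ≫ K.map f ◁ K.map₂ δ ≫ eqToHom (K.map_comp f g').symm := by
  rw [K.map₂_whisker_left, K.mapComp_eq_eqToIso, K.mapComp_eq_eqToIso]
  rfl

/-- The 2-functor `A(K(-), -) : Bᵒᵖ × A ⥤ Cat`. -/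
def homTwoFunctor (K : StrictPseudofunctor B A) :
    StrictPseudofunctor (Bᵒᵖ × A) Cat.{w, v} :=
  StrictPseudofunctor.mk''
    { obj := fun p => Cat.of (K.obj p.1.unop ⟶ p.2)
      map := fun f => (homMap (K.map f.1.unop) f.2).toCatHom
      map₂ := fun δ => NatTrans.toCatHom₂ (homMap₂ (K.map₂ δ.1.unop2) δ.2)
      map₂_id := by
        intro p q f
        ext h
        refine Eq.trans ?_ (whiskers_id (K.map f.1.unop) f.2 h)
        rw [← K.map₂_id]
        rfl
      map₂_comp := by
        intro p q f g k δ δ'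
        ext h
        refine Eq.trans ?_ (whiskers_comp (K.map₂ δ.1.unop2) (K.map₂ δ'.1.unop2) δ.2 δ'.2 h)
        rw [← K.map₂_comp]
        rfl
      map_id := by
        intro p
        apply Cat.Hom.ext
        change homMap (K.map (𝟙 p.1.unop)) (𝟙 p.2) = 𝟭 _
        rw [K.map_id, homMap_id]
      map_comp := by
        intro p q r f g
        apply Cat.Hom.ext
        change homMap (K.map (g.1.unop ≫ f.1.unop)) (f.2 ≫ g.2) =
          homMap (K.map f.1.unop) f.2 ⋙ homMap (K.map g.1.unop) g.2
        rw [K.map_comp, homMap_comp]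
      map₂_whisker_left := by
        intro p q r f g g' δ
        apply Cat.Hom₂.ext
        rw [Cat.Hom.toNatTrans_comp, Cat.Hom.toNatTrans_comp, Cat.Hom₂.eqToHom_toNatTrans,
          Cat.Hom₂.eqToHom_toNatTrans]
        change homMap₂ (K.map₂ (δ.1.unop2 ▷ f.1.unop)) (f.2 ◁ δ.2) = _
        rw [strict_map₂_whiskerRight]
        exact homMap₂_left _ _ _ _ (K.map_comp _ _) (K.map_comp _ _)
      map₂_whisker_right := by
        intro p q r f f' δ g
        apply Cat.Hom₂.ext
        rw [Cat.Hom.toNatTrans_comp, Cat.Hom.toNatTrans_comp, Cat.Hom₂.eqToHom_toNatTrans,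
          Cat.Hom₂.eqToHom_toNatTrans]
        change homMap₂ (K.map₂ (g.1.unop ◁ δ.1.unop2)) (δ.2 ▷ g.2) = _
        rw [strict_map₂_whiskerLeft]
        exact homMap₂_right _ _ _ _ (K.map_comp _ _) (K.map_comp _ _) }

end HomTwoFunctor

/-- The object of the hom-category corresponding to `id : K b ⟶ K b`, as a functor
`1 ⥤ A(K b, K b)`. -/
def pickId (K : StrictPseudofunctor B A) (b : B) :
    Cat.chosenTerminal.{w, v} ⟶ (homTwoFunctor K).obj (op b, K.obj b) :=
  Cat.Hom.ofFunctor (Cat.fromChosenTerminalEquiv.symm (𝟙 (K.obj b)))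

lemma pickId_mapR (K : StrictPseudofunctor B A) {b b' : B} (f : b ⟶ b') :
    pickId K b ≫ mapR (homTwoFunctor K) b (K.map f) =
      pickId K b' ≫ mapL (homTwoFunctor K) f (K.obj b') := by
  apply Cat.Hom.ext
  apply Cat.fromChosenTerminalEquiv.injective
  change (K.map (𝟙 b) ≫ 𝟙 (K.obj b)) ≫ K.map f = (K.map f ≫ 𝟙 (K.obj b')) ≫ 𝟙 (K.obj b')
  rw [K.map_id]
  simp only [Strict.id_comp, Strict.comp_id]

/-- Evaluation of an oplax-cart-lax natural transformation `α : A(K(-), -) ⟶ F` at identities: the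
components are `1 ⟶ A(K b, K b) ⟶ F(b, K b)`, and the structure 2-cell at `f : b ⟶ b'` is the pasting
of the structure 2-cell of `α` at `K f` with the one at `f`, along `K f ∘ id = id ∘ K f`. -/
def evalId {K : StrictPseudofunctor B A} {σ : SplitDiscreteTwoOpfibration K}
    {F : StrictPseudofunctor (Bᵒᵖ × A) Cat.{w, v}}
    (α : OplaxCartLaxTrans σ (homTwoFunctor K) F) :
    ExtraordinaryLaxData K Cat.chosenTerminal.{w, v} F where
  app b := pickId K b ≫ α.app b (K.obj b)
  cell {b b'} f :=
    (α_ _ _ _).hom ≫ pickId K b ◁ α.laxCell b (K.map f) ≫ (α_ _ _ _).inv ≫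
      eqToHom (pickId_mapR K f) ▷ α.app b (K.obj b') ≫ (α_ _ _ _).hom ≫
        pickId K b' ◁ α.oplaxCell f (K.obj b') ≫ (α_ _ _ _).inv

end OplaxCartLax

/-! The two halves of the hypothesis on `K` say that a 1-cell out of `K b` is `K h` for exactly one
chosen lift `h`, and that a 2-cell into `K k` is `K δ` for exactly one `δ` with codomain `k`. Data
indexed by 1-cells or 2-cells out of `K b` can therefore be defined and checked on such images
(`rec₁`, `rec₂`, `ind₂`). Moreover every 1-cell `k` of `B` factors uniquely as a chosen lift `h`
followed by a vertical 1-cell `t`, that is, one with `K t` an identity.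

This makes a transformation α rigid. Its oplax cell at a chosen `h : b ⟶ d` is an identity, so its
value at `K h` is F(h, id) applied to η_d. For vertical `t` the lax cell at `K t` is an identity, so
the oplax cell of `t` at the identity is η_t; hence the oplax cell of `k = h ≫ t` at the identity is
F(h, id)(η_t). Naturality in 2-cells and compatibility then express all of α through η.

Conversely these formulas serve as definitions. The morphism F(h, id)(η_t) is `comparison k`, from
the value at `K k` to F(k, id)(η_e). For `δ : k' ⟶ k` with `k` chosen, `K δ` goes to `comparison k'`
followed by F(δ, id); the oplax cell of `f` at `K h` is `comparison (f ≫ h)`; the lax cell at `K h`,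
`K m` is F(h, id)(η_m). Most of the axioms come down to `extMap_comparison`, `extOpl_comparison` and
`extLax_comparison`, which extend the formulas to 1-cells that are not chosen lifts.

Modifications behave alike: Θ at `K h` must be F(h, id)(Γ_d), and this formula always defines a
modification, so evaluation is fully faithful. If α and β have equal evaluations, extending the
family of identities gives a modification with identity components, whence α = β. A fully faithful
functor bijective on objects is an isomorphism (`exists_inverse_functor`).

Strict functoriality yields only propositional equalities of objects; the relations `Same`, `Comp`
and `Sq` keep the resulting transports out of the diagram chases. -/

namespace OplaxCartLax

/-! ### Equality of morphisms up to transport along equalities of objects -/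

section Same

/-- Morphisms `f : X ⟶ Y` and `f' : X' ⟶ Y'` are the same if `X = X'`, `Y = Y'`, and `f = f'` along
these equalities. -/
inductive Same {C : Type u} [Category.{v} C] {X Y : C} (f : X ⟶ Y) :
    ∀ {X' Y' : C}, (X' ⟶ Y') → Prop
  | refl : Same f f

infix:50 " ≐ " => Same

/-- `Comp f g k` says that `k` is the composite of `f` and `g`, along equalities of objects. -/
def Comp {C : Type u} [Category.{v} C] {X Y Y' Z X' Z' : C} (f : X ⟶ Y) (g : Y' ⟶ Z)
    (k : X' ⟶ Z') : Prop :=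
  ∃ h : Y = Y', f ≫ eqToHom h ≫ g ≐ k

/-- `Sq f g f' g'` says that `f ≫ g = f' ≫ g'`, along equalities of objects. -/
def Sq {C : Type u} [Category.{v} C] {X Y Y' Z X' W W' Z' : C} (f : X ⟶ Y) (g : Y' ⟶ Z)
    (f' : X' ⟶ W) (g' : W' ⟶ Z') : Prop :=
  ∃ (S T : C) (k : S ⟶ T), Comp f g k ∧ Comp f' g' k

variable {C : Type u} [Category.{v} C] {D : Type u₁} [Category.{v₁} D]
  {X Y Z W X' Y' Z' W' X'' Y'' Z'' : C}

namespace Same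

lemma symm {f : X ⟶ Y} {g : X' ⟶ Y'} (h : f ≐ g) : g ≐ f := by
  cases h
  exact .refl

lemma trans {f : X ⟶ Y} {g : X' ⟶ Y'} {k : X'' ⟶ Y''} (h : f ≐ g) (h' : g ≐ k) : f ≐ k := by
  cases h
  exact h'

lemma of_eq {f g : X ⟶ Y} (h : f = g) : f ≐ g := h ▸ .refl

lemma eq {f g : X ⟶ Y} (h : f ≐ g) : f = g := by
  cases h
  rfl

lemma target {f : X ⟶ Y} {g : X' ⟶ Y'} (h : f ≐ g) : Y = Y' := by
  cases h
  rfl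

lemma map (F : C ⥤ D) {f : X ⟶ Y} {g : X' ⟶ Y'} (h : f ≐ g) : F.map f ≐ F.map g := by
  cases h
  exact .refl

lemma id (h : X = X') : 𝟙 X ≐ 𝟙 X' := by
  subst h
  exact .refl

@[simp]
lemma eqToHom_comp_iff (p : Z = X) (f : X ⟶ Y) (g : X' ⟶ Y') : eqToHom p ≫ f ≐ g ↔ f ≐ g := by
  subst p
  simp

@[simp]
lemma comp_eqToHom_iff (p : Y = Z) (f : X ⟶ Y) (g : X' ⟶ Y') : f ≫ eqToHom p ≐ g ↔ f ≐ g := by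
  subst p
  simp

@[simp]
lemma iff_eqToHom_comp (p : Z = X') (f : X ⟶ Y) (g : X' ⟶ Y') : f ≐ eqToHom p ≫ g ↔ f ≐ g := by
  subst p
  simp

@[simp]
lemma iff_comp_eqToHom (p : Y' = Z) (f : X ⟶ Y) (g : X' ⟶ Y') : f ≐ g ≫ eqToHom p ↔ f ≐ g := by
  subst p
  simp

@[simp]
lemma comp_comp_eqToHom_iff (p : Y = Z) (f : X ⟶ W) (k : W ⟶ Y) (g : X' ⟶ Y') :
    f ≫ k ≫ eqToHom p ≐ g ↔ f ≫ k ≐ g := by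
  subst p
  simp

@[simp]
lemma iff_comp_comp_eqToHom (p : Y' = Z) (f : X ⟶ Y) (g : X' ⟶ W) (k : W ⟶ Y') :
    f ≐ g ≫ k ≫ eqToHom p ↔ f ≐ g ≫ k := by
  subst p
  simp

lemma eqToHom_iff (p : X = Y) (f : X' ⟶ Y') : eqToHom p ≐ f ↔ 𝟙 X ≐ f := by
  subst p
  simp

lemma iff_eqToHom (p : X' = Y') (f : X ⟶ Y) : f ≐ eqToHom p ↔ f ≐ 𝟙 X' := by
  subst p
  simp

lemma functor {F G : C ⥤ D} (h : F = G) (f : X ⟶ Y) : F.map f ≐ G.map f := by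
  subst h
  exact .refl

lemma app {F G : C ⥤ D} (τ : F ⟶ G) (h : X = Y) : τ.app X ≐ τ.app Y := by
  subst h
  exact .refl

end Same

namespace Comp

lemma mk {f : X ⟶ Y} {g : Y ⟶ Z} : Comp f g (f ≫ g) := ⟨rfl, by simpa using .refl⟩

lemma mk_cast {f : X ⟶ Y} {g : Y' ⟶ Z} (h : Y = Y') : Comp f g (f ≫ eqToHom h ≫ g) := ⟨h, .refl⟩

lemma congr {f : X ⟶ Y} {g : Y' ⟶ Z} {k : X' ⟶ Z'} (h : Comp f g k)
    {X₁ Y₁ Y₁' Z₁ X₁' Z₁' : C} {f₁ : X₁ ⟶ Y₁} {g₁ : Y₁' ⟶ Z₁} {k₁ : X₁' ⟶ Z₁'}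
    (hf : f ≐ f₁) (hg : g ≐ g₁) (hk : k ≐ k₁) : Comp f₁ g₁ k₁ := by
  cases hf
  cases hg
  cases hk
  exact h

lemma same {f : X ⟶ Y} {g : Y' ⟶ Z} {k : X' ⟶ Z'} {k' : X'' ⟶ Z''} (h : Comp f g k)
    (h' : Comp f g k') : k ≐ k' := by
  obtain ⟨_, h⟩ := h
  obtain ⟨_, h'⟩ := h'
  exact h.symm.trans h'

lemma eq {f : X ⟶ Y} {g : Y ⟶ Z} {k : X ⟶ Z} (h : Comp f g k) : f ≫ g = k :=
  (mk.same h).eq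

lemma map (F : C ⥤ D) {f : X ⟶ Y} {g : Y' ⟶ Z} {k : X' ⟶ Z'} (h : Comp f g k) :
    Comp (F.map f) (F.map g) (F.map k) := by
  obtain ⟨rfl, h⟩ := h
  cases h
  simpa using mk

/-- Associativity without naming transports: the bracketing is moved from the left to the right. The
variants `assoc'` and `exists_assoc` move it back, or produce the triple composite. -/
lemma assoc {f : X ⟶ Y} {g : Y' ⟶ Z} {k : Z' ⟶ W} {A₁ A₂ B₁ B₂ C₁ C₂ : C} {a : A₁ ⟶ A₂}
    {b : B₁ ⟶ B₂} {c : C₁ ⟶ C₂} (h : Comp f g a) (h' : Comp a k c) (h'' : Comp g k b) :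
    Comp f b c := by
  obtain ⟨rfl, h⟩ := h
  cases h
  obtain ⟨rfl, h'⟩ := h'
  cases h'
  obtain ⟨_, h''⟩ := h''
  cases h''
  simpa using mk

lemma assoc' {f : X ⟶ Y} {g : Y' ⟶ Z} {k : Z' ⟶ W} {A₁ A₂ B₁ B₂ C₁ C₂ : C} {a : A₁ ⟶ A₂}
    {b : B₁ ⟶ B₂} {c : C₁ ⟶ C₂} (h : Comp f g a) (h' : Comp g k b) (h'' : Comp f b c) :
    Comp a k c := by
  obtain ⟨rfl, h⟩ := h
  cases h
  obtain ⟨rfl, h'⟩ := h'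
  cases h'
  obtain ⟨_, h''⟩ := h''
  cases h''
  simpa using mk (f := f ≫ g) (g := k)

lemma exists_assoc {f : X ⟶ Y} {g : Y' ⟶ Z} {k : Z' ⟶ W} {A₁ A₂ B₁ B₂ : C} {a : A₁ ⟶ A₂}
    {b : B₁ ⟶ B₂} (h : Comp f g a) (h' : Comp g k b) :
    ∃ z : X ⟶ W, Comp a k z ∧ Comp f b z := by
  obtain ⟨rfl, h⟩ := h
  cases h
  obtain ⟨rfl, h'⟩ := h'
  cases h'
  exact ⟨f ≫ g ≫ k, by simpa using mk (f := f ≫ g) (g := k), by simpa using mk⟩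

/-- The unit law up to transport. It is the means of cancelling structure cells known to be
identities, such as those at chosen lifts. -/
lemma same_of_left {f : X ⟶ Y} {g : Y' ⟶ Z} {k : X' ⟶ Z'} (h : Comp f g k) (hf : f ≐ 𝟙 W) :
    g ≐ k := by
  cases hf
  obtain ⟨rfl, h⟩ := h
  simpa using h

lemma same_of_right {f : X ⟶ Y} {g : Y' ⟶ Z} {k : X' ⟶ Z'} (h : Comp f g k) (hg : g ≐ 𝟙 W) :
    f ≐ k := by
  cases hg
  obtain ⟨rfl, h⟩ := h
  simpa using h

lemma of_right {f : X ⟶ Y} {g : Y' ⟶ Z} {k : X' ⟶ Z'} (hg : g ≐ 𝟙 W) (h : Y = Y') (hf : f ≐ k) :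
    Comp f g k := by
  cases hg
  subst h
  cases hf
  simpa using mk (f := f) (g := 𝟙 Y)

lemma sq {f : X ⟶ Y} {g : Y' ⟶ Z} {k : X' ⟶ Z'} {W₁ W₂ W₃ W₄ : C} {f' : W₁ ⟶ W₂} {g' : W₃ ⟶ W₄}
    (h : Comp f g k) (h' : Comp f' g' k) : Sq f g f' g' := ⟨_, _, k, h, h'⟩

/-- A composite `p ≫ q ≫ r ≫ s` may be rewritten along a square `q ≫ r = u ≫ t`. -/
lemma interchange {A₁ A₂ B₁ B₂ C₁ C₂ D₁ D₂ E₁ E₂ F₁ F₂ G₁ G₂ H₁ H₂ I₁ I₂ J₁ J₂ K₁ K₂ : C}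
    {p : A₁ ⟶ A₂} {q : B₁ ⟶ B₂} {r : C₁ ⟶ C₂} {s : D₁ ⟶ D₂} {u : E₁ ⟶ E₂} {t : F₁ ⟶ F₂}
    {a : G₁ ⟶ G₂} {b : H₁ ⟶ H₂} {c : I₁ ⟶ I₂} {a' : J₁ ⟶ J₂} {b' : K₁ ⟶ K₂} (h : Comp p q a)
    (h' : Comp r s b) (hc : Comp a b c) (hs : Sq q r u t) (k : Comp p u a') (k' : Comp t s b') :
    Comp a' b' c := by
  obtain ⟨_, _, m, hm, hm'⟩ := hs
  obtain ⟨n, hn, hn'⟩ := hm.exists_assoc h'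
  exact k.assoc' (hm'.assoc hn k') (h.assoc hc hn')

end Comp

namespace Sq

variable {W₁ W₂ W₃ W₄ : C} {f : X ⟶ Y} {g : Y' ⟶ Z} {f' : W₁ ⟶ W₂} {g' : W₃ ⟶ W₄}

lemma symm (h : Sq f g f' g') : Sq f' g' f g := by
  obtain ⟨_, _, k, h, h'⟩ := h
  exact ⟨_, _, k, h', h⟩

lemma comp (h : Sq f g f' g') {k : X'' ⟶ Y''} (hk : Comp f g k) : Comp f' g' k := by
  obtain ⟨_, _, k', h, h'⟩ := h
  exact h'.congr .refl .refl (h.same hk)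

lemma congr (h : Sq f g f' g')
    {X₁ Y₁ Y₁' Z₁ : C} {f₁ : X₁ ⟶ Y₁} {g₁ : Y₁' ⟶ Z₁}
    {X₂ Y₂ Y₂' Z₂ : C} {f₂ : X₂ ⟶ Y₂} {g₂ : Y₂' ⟶ Z₂}
    (hf : f ≐ f₁) (hg : g ≐ g₁) (hf' : f' ≐ f₂) (hg' : g' ≐ g₂) : Sq f₁ g₁ f₂ g₂ := by
  cases hf
  cases hg
  cases hf'
  cases hg'
  exact h

lemma map (F : C ⥤ D) (h : Sq f g f' g') : Sq (F.map f) (F.map g) (F.map f') (F.map g') := by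
  obtain ⟨_, _, k, h, h'⟩ := h
  exact ⟨_, _, F.map k, h.map F, h'.map F⟩

lemma of_eq {f : X ⟶ Y} {g : Y ⟶ Z} {f' : X ⟶ W} {g' : W ⟶ Z} (h : f ≫ g = f' ≫ g') :
    Sq f g f' g' :=
  ⟨_, _, f ≫ g, Comp.mk, h ▸ Comp.mk⟩

lemma eq {f : X ⟶ Y} {g : Y ⟶ Z} {f' : X ⟶ W} {g' : W ⟶ Z} (h : Sq f g f' g') :
    f ≫ g = f' ≫ g' := by
  obtain ⟨_, _, k, h, h'⟩ := h
  obtain ⟨_, h⟩ := h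
  obtain ⟨_, h'⟩ := h'
  simpa using (h.trans h'.symm).eq

lemma app {F G : C ⥤ D} (τ : F ⟶ G) (f : X ⟶ Y) :
    Sq (F.map f) (τ.app Y) (τ.app X) (G.map f) :=
  of_eq (τ.naturality f)

/-- Pasting a square on the right of a composite. -/
lemma paste {A₁ A₂ B₁ B₂ C₁ C₂ D₁ D₂ E₁ E₂ F₁ F₂ G₁ G₂ : C} {p : A₁ ⟶ A₂} {q : B₁ ⟶ B₂}
    {s : C₁ ⟶ C₂} {r : D₁ ⟶ D₂} {u : E₁ ⟶ E₂} {a : F₁ ⟶ F₂} {c : G₁ ⟶ G₂} (ha : Comp p q a)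
    (h : Sq q s r u) (hc : Comp p r c) : Sq a s c u := by
  obtain ⟨_, _, m, hm, hm'⟩ := h
  obtain ⟨z, hz, hz'⟩ := ha.exists_assoc hm
  exact ⟨_, _, z, hz, hc.assoc' hm' hz'⟩

/-- Decomposing one side of a square. -/
lemma assoc_right {A₁ A₂ B₁ B₂ C₁ C₂ D₁ D₂ E₁ E₂ F₁ F₂ G₁ G₂ : C} {p : A₁ ⟶ A₂} {q : B₁ ⟶ B₂}
    {c : C₁ ⟶ C₂} {u : D₁ ⟶ D₂} {o : E₁ ⟶ E₂} {l : F₁ ⟶ F₂} {m : G₁ ⟶ G₂} (h : Sq p q c u)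
    (hc : Comp o l c) (hm : Comp l u m) : Sq p q o m := by
  obtain ⟨_, _, k, hk, hk'⟩ := h
  exact ⟨_, _, k, hk, hc.assoc hk' hm⟩

lemma comp_right {A₁ A₂ B₁ B₂ C₁ C₂ D₁ D₂ E₁ E₂ F₁ F₂ G₁ G₂ H₁ H₂ : C} {p : A₁ ⟶ A₂}
    {q : B₁ ⟶ B₂} {r : C₁ ⟶ C₂} {s : D₁ ⟶ D₂} {t : E₁ ⟶ E₂} {b : F₁ ⟶ F₂} {d : G₁ ⟶ G₂}
    {c : H₁ ⟶ H₂} (h : Sq p q r s) (hb : Comp q t b) (hd : Comp s t d) (hc : Comp r d c) :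
    Comp p b c := by
  obtain ⟨_, _, k, hk, hk'⟩ := h
  obtain ⟨z, hz, hz'⟩ := hk'.exists_assoc hd
  exact hk.assoc (hz.congr .refl .refl (hz'.same hc)) hb

end Sq

end Same

/-! ### Whiskering and strict 2-functors up to transport. -/

section Bicategories

variable {E : Type u} [Bicategory.{w, v} E]

lemma Same.whisker_right {a b c : E} {g h g' h' : a ⟶ b} {θ : g ⟶ h} {θ' : g' ⟶ h'}
    (e : θ ≐ θ') (f : b ⟶ c) : θ ▷ f ≐ θ' ▷ f := by
  cases e
  exact .refl

lemma Same.id_whisker_left [Strict E] {a b : E} {f g : a ⟶ b} (θ : f ⟶ g) : 𝟙 a ◁ θ ≐ θ := by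
  simpa [Strict.leftUnitor_eqToIso] using .refl

lemma Same.whisker_right_id [Strict E] {a b : E} {f g : a ⟶ b} (θ : f ⟶ g) : θ ▷ 𝟙 b ≐ θ := by
  simpa [Strict.rightUnitor_eqToIso] using .refl

lemma Same.left_congr {a b c : E} {f f' : a ⟶ b} (h : f = f') {g k : b ⟶ c} (θ : g ⟶ k) :
    f ◁ θ ≐ f' ◁ θ := by
  subst h
  exact .refl

variable {E' : Type u₁} [Bicategory.{w₁, v₁} E']

lemma Same.map₂ (F : StrictPseudofunctor E E') {a b : E} {f g f' g' : a ⟶ b} {θ : f ⟶ g}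
    {θ' : f' ⟶ g'} (h : θ ≐ θ') : F.map₂ θ ≐ F.map₂ θ' := by
  cases h
  exact .refl

lemma Same.map₂_whisker_left [Strict E] [Strict E'] (F : StrictPseudofunctor E E') {a b c : E}
    (f : a ⟶ b) {g h : b ⟶ c}
    (θ : g ⟶ h) : F.map₂ (f ◁ θ) ≐ F.map f ◁ F.map₂ θ := by
  rw [strict_map₂_whiskerLeft]
  simpa using .refl

lemma Same.map₂_whisker_right [Strict E] [Strict E'] (F : StrictPseudofunctor E E') {a b c : E}
    {f g : a ⟶ b}
    (θ : f ⟶ g) (h : b ⟶ c) : F.map₂ (θ ▷ h) ≐ F.map₂ θ ▷ F.map h := by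
  rw [strict_map₂_whiskerRight]
  simpa using .refl

lemma Same.prod {a b : E} {c d : E'} {f g f' g' : a ⟶ b} {h k h' k' : c ⟶ d} {θ : f ⟶ g}
    {θ' : f' ⟶ g'} {τ : h ⟶ k} {τ' : h' ⟶ k'} (e : θ ≐ θ') (e' : τ ≐ τ') :
    Same (C := ((a, c) : E × E') ⟶ (b, d)) (X := f ×ₘ h) (Y := g ×ₘ k) (X' := f' ×ₘ h')
      (Y' := g' ×ₘ k') (θ ×ₘ τ) (θ' ×ₘ τ') := by
  cases e
  cases e'
  exact .refl

lemma Same.toNatTrans_app {C D : Cat.{w, v}} {f g f' g' : C ⟶ D} {θ : f ⟶ g} {θ' : f' ⟶ g'}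
    (e : θ ≐ θ') (X : C) : θ.toNatTrans.app X ≐ θ'.toNatTrans.app X := by
  cases e
  exact .refl

end Bicategories

end OplaxCartLax

namespace OplaxCartLax

/-! ### Induction along split discrete 2-opfibrations -/

section Lifts

variable {A : Type u} [Bicategory.{w, v} A] [Strict A]
  {B : Type u₁} [Bicategory.{w₁, v₁} B] [Strict B]
  {K : StrictPseudofunctor B A} (σ : SplitDiscreteTwoOpfibration K)

lemma isHomLift_codomain_eq {X : Type*} [Category X] {S : Type*} [Category S] {P : X ⥤ S}
    {x y : X} {s t : S} {u : s ⟶ t} {f : x ⟶ y} (h : P.IsHomLift u f) : P.obj y = t :=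
  IsHomLift.codomain_eq P u f

lemma isHomLift_eq_map {X : Type*} [Category X] {S : Type*} [Category S] {P : X ⥤ S}
    {x y : X} {u : P.obj x ⟶ P.obj y} {f : x ⟶ y} (h : P.IsHomLift u f) : u = P.map f :=
  IsHomLift.eq_of_isHomLift P u f

lemma isHomLift_id {X : Type*} [Category X] {S : Type*} [Category S] {P : X ⥤ S}
    {x y : X} {s : S} {f : x ⟶ y} (h : P.IsHomLift (𝟙 s) f) (p : P.obj x = P.obj y) :
    P.map f = eqToHom p := by
  rw [IsHomLift.fac' P (𝟙 s) f]
  simp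

namespace SplitDiscreteTwoOpfibration

/-- The chosen cocartesian lifts of `K`, in terms of the 2-category structures. -/
def Chosen {b d : B} (h : b ⟶ d) : Prop :=
  σ.cleavage.IsChosen (P := K.toFunctor) h

/-- Witnesses that a 1-cell out of `K b` is the image of a chosen lift. -/
inductive Lift (b : B) : ∀ {a : A}, (K.obj b ⟶ a) → Type (max u₁ v₁)
  | mk {d : B} (h : b ⟶ d) (hh : σ.Chosen h) : Lift b (K.map h)

/-- Witnesses that a 2-cell between 1-cells out of `K b` is the image of a 2-cell whose codomain is
a chosen lift. -/
inductive TwoLift (b : B) : ∀ {a : A} {x y : K.obj b ⟶ a}, (x ⟶ y) → Type (max u₁ v₁ w₁)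
  | mk {d : B} {k' k : b ⟶ d} (hk : σ.Chosen k) (δ : k' ⟶ k) : TwoLift b (K.map₂ δ)

variable {σ}

/-- Being chosen means being the value of the cleavage at one's own image, so source and image
determine the lift. The images are compared heterogeneously because their codomains are only
propositionally equal. -/
lemma chosen_lift_unique {b d d' : B} {h : b ⟶ d} {h' : b ⟶ d'} (hh : σ.Chosen h)
    (hh' : σ.Chosen h') (p : K.obj d = K.obj d') (q : K.map h ≍ K.map h') :
    (⟨d, h⟩ : Σ e : B, b ⟶ e) = ⟨d', h'⟩ := by
  have key : ∀ {a a' : A} (p : a = a') (x : K.obj b ⟶ a) (x' : K.obj b ⟶ a') (_ : x ≍ x'),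
      (⟨σ.cleavage.cod b (S := A) x, σ.cleavage.lift b (S := A) x⟩ : Σ e : B, b ⟶ e) =
        ⟨σ.cleavage.cod b (S := A) x', σ.cleavage.lift b (S := A) x'⟩ := by
    rintro a _ rfl x _ ⟨⟩
    rfl
  exact (Eq.trans hh (key p _ _ q)).trans (Eq.symm hh')

/-- The definition of chosen refers to the cleavage at the image of the lift, not at the given `x`;
the two agree only after transport along the lifting property. -/
lemma lift_chosen {b : B} {a : A} (x : K.obj b ⟶ a) :
    σ.Chosen (σ.cleavage.lift b (S := A) x) := by
  have key : ∀ {a' : A} (x' : K.obj b ⟶ a') {d : B} (h : b ⟶ d),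
      K.toFunctor.IsHomLift x' h →
      (⟨σ.cleavage.cod b (S := A) x', σ.cleavage.lift b (S := A) x'⟩ : Σ e : B, b ⟶ e) =
        ⟨σ.cleavage.cod b (S := A) (K.map h), σ.cleavage.lift b (S := A) (K.map h)⟩ := by
    intro a' x' d h hl
    obtain rfl : K.obj d = a' := isHomLift_codomain_eq hl
    obtain rfl : x' = K.map h := isHomLift_eq_map hl
    rfl
  exact key x _ (σ.cleavage.isStronglyCocartesian b x).toIsHomLift

lemma nonempty_lift {b : B} {a : A} (x : K.obj b ⟶ a) : Nonempty (σ.Lift b x) := by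
  have key : ∀ {a' : A} (x' : K.obj b ⟶ a') {d : B} (h : b ⟶ d),
      K.toFunctor.IsHomLift x' h → σ.Chosen h → Nonempty (σ.Lift b x') := by
    intro a' x' d h hl hh
    obtain rfl : K.obj d = a' := isHomLift_codomain_eq hl
    obtain rfl : x' = K.map h := isHomLift_eq_map hl
    exact ⟨.mk h hh⟩
  exact key x _ (σ.cleavage.isStronglyCocartesian b x).toIsHomLift (lift_chosen x)

/-- Uniqueness of the witness is what gives `rec₁` its computation rule: on `K h` the classically
chosen witness can only be `h` itself. -/
instance {b : B} {a : A} (x : K.obj b ⟶ a) : Subsingleton (σ.Lift b x) := by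
  have key : ∀ {a a' : A} (x : K.obj b ⟶ a) (x' : K.obj b ⟶ a') (s : σ.Lift b x)
      (s' : σ.Lift b x'), a = a' → x ≍ x' → s ≍ s' := by
    rintro _ _ _ _ ⟨h, hh⟩ ⟨h', hh'⟩ p q
    cases chosen_lift_unique hh hh' p q
    rfl
  exact ⟨fun s s' => eq_of_heq (key x x s s' rfl .rfl)⟩

variable (σ) in
/-- To construct something for all 1-cells out of `K b`, it suffices to do so for the images of
chosen lifts. -/
noncomputable def rec₁ {b : B} {motive : ∀ {a : A}, (K.obj b ⟶ a) → Sort*}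
    (H : ∀ {d : B} (h : b ⟶ d), σ.Chosen h → motive (K.map h)) {a : A} (x : K.obj b ⟶ a) :
    motive x :=
  match Classical.choice (nonempty_lift (σ := σ) x) with
  | .mk h hh => H h hh

lemma rec₁_map {b : B} {motive : ∀ {a : A}, (K.obj b ⟶ a) → Sort*}
    (H : ∀ {d : B} (h : b ⟶ d), σ.Chosen h → motive (K.map h)) {d : B} (h : b ⟶ d)
    (hh : σ.Chosen h) : σ.rec₁ (motive := motive) H (K.map h) = H h hh := by
  rw [rec₁, Subsingleton.elim (Classical.choice _) (Lift.mk h hh)]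

/-- The uniqueness half of the discrete fibration property, with the domain bundled because it is
itself determined. -/
lemma discrete_unique (σ : SplitDiscreteTwoOpfibration K) {b d : B} {k k₁ k₂ : b ⟶ d} (δ₁ : k₁ ⟶ k) (δ₂ : k₂ ⟶ k)
    (h : K.map₂ δ₁ ≐ K.map₂ δ₂) : (⟨k₁, δ₁⟩ : Σ y : b ⟶ d, y ⟶ k) = ⟨k₂, δ₂⟩ := by
  obtain ⟨p, _, hp⟩ := σ.isDiscreteFibration b d k (K.map₂ δ₁)
  have key : ∀ {s : K.obj b ⟶ K.obj d} (u : s ⟶ K.map k), K.map₂ δ₁ ≐ u →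
      (K.mapFunctor b d).IsHomLift u δ₂ → (K.mapFunctor b d).IsHomLift (K.map₂ δ₁) δ₂ := by
    rintro s u ⟨⟩ h
    exact h
  exact (hp ⟨k₁, δ₁⟩ (.map δ₁)).trans (hp ⟨k₂, δ₂⟩ (key _ h (.map δ₂))).symm

/-- To prove something for all 2-cells with codomain `K k`, it suffices to do so for the images of
2-cells with codomain `k`. -/
lemma ind₂ (σ : SplitDiscreteTwoOpfibration K) {b d : B} {k : b ⟶ d}
    {motive : ∀ {x : K.obj b ⟶ K.obj d}, (x ⟶ K.map k) → Prop}
    (H : ∀ {k' : b ⟶ d} (δ : k' ⟶ k), motive (K.map₂ δ)) {x : K.obj b ⟶ K.obj d}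
    (ξ : x ⟶ K.map k) : motive ξ := by
  obtain ⟨⟨k', δ⟩, h, -⟩ := σ.isDiscreteFibration _ _ k ξ
  have key : ∀ {s : K.obj b ⟶ K.obj d} (u : s ⟶ K.map k),
      (K.mapFunctor b d).IsHomLift u δ → motive u := by
    intro s u h
    have hs : K.map k' = s := IsHomLift.domain_eq (K.mapFunctor b _) u δ
    subst hs
    have hu : u = K.map₂ δ := isHomLift_eq_map h
    subst hu
    exact H δ
  exact key ξ h

lemma nonempty_twoLift {b : B} {a : A} {x y : K.obj b ⟶ a} (ξ : x ⟶ y) :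
    Nonempty (σ.TwoLift b ξ) := by
  obtain ⟨k, hk⟩ := nonempty_lift (σ := σ) y
  exact ind₂ σ (motive := fun ξ => Nonempty (σ.TwoLift b ξ)) (fun δ => ⟨.mk hk δ⟩) ξ

/-- The codomain determines the chosen lift, and then discreteness determines the 2-cell above it.
-/
instance {b : B} {a : A} {x y : K.obj b ⟶ a} (ξ : x ⟶ y) : Subsingleton (σ.TwoLift b ξ) := by
  have key : ∀ {a a' : A} {x y : K.obj b ⟶ a} {x' y' : K.obj b ⟶ a'} (ξ : x ⟶ y) (ξ' : x' ⟶ y')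
      (s : σ.TwoLift b ξ) (s' : σ.TwoLift b ξ'), a = a' → x ≍ x' → y ≍ y' → ξ ≍ ξ' → s ≍ s' := by
    rintro _ _ _ _ _ _ _ _ ⟨hk, δ⟩ ⟨hk', δ'⟩ p hx hy hξ
    cases chosen_lift_unique hk hk' p hy
    have : K.map₂ δ ≐ K.map₂ δ' := by
      clear * - hx hξ
      generalize K.map₂ δ = ξ, K.map₂ δ' = ξ' at *
      revert ξ ξ'
      rw [eq_of_heq hx]
      rintro ξ ξ' ⟨⟩
      exact .refl
    cases discrete_unique σ δ δ' this
    rfl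
  exact ⟨fun s s' => eq_of_heq (key ξ ξ s s' rfl .rfl .rfl .rfl)⟩

variable (σ) in
/-- To construct something for all 2-cells between 1-cells out of `K b`, it suffices to do so for
the images of 2-cells whose codomain is a chosen lift. -/
noncomputable def rec₂ {b : B} {motive : ∀ {a : A} {x y : K.obj b ⟶ a}, (x ⟶ y) → Sort*}
    (H : ∀ {d : B} {k' k : b ⟶ d} (_ : σ.Chosen k) (δ : k' ⟶ k), motive (K.map₂ δ)) {a : A}
    {x y : K.obj b ⟶ a} (ξ : x ⟶ y) : motive ξ :=
  match Classical.choice (nonempty_twoLift (σ := σ) ξ) with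
  | .mk hk δ => H hk δ

lemma rec₂_map {b : B} {motive : ∀ {a : A} {x y : K.obj b ⟶ a}, (x ⟶ y) → Sort*}
    (H : ∀ {d : B} {k' k : b ⟶ d} (_ : σ.Chosen k) (δ : k' ⟶ k), motive (K.map₂ δ)) {d : B}
    {k' k : b ⟶ d} (hk : σ.Chosen k) (δ : k' ⟶ k) :
    σ.rec₂ (motive := motive) H (K.map₂ δ) = H hk δ := by
  rw [rec₂, Subsingleton.elim (Classical.choice _) (TwoLift.mk hk δ)]

lemma chosen_id (b : B) : σ.Chosen (𝟙 b) := by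
  have h := σ.cleavage.lift_id (P := K.toFunctor) b
  have key : ∀ (y : K.obj b ⟶ K.obj b), y = 𝟙 (K.obj b) →
      (⟨b, 𝟙 b⟩ : Σ e : B, b ⟶ e) =
        ⟨σ.cleavage.cod b (S := A) y, σ.cleavage.lift b (S := A) y⟩ := by
    rintro _ rfl
    exact h.symm
  exact key (K.map (𝟙 b)) (K.map_id b)

lemma chosen_comp {b d e : B} {h : b ⟶ d} {m : d ⟶ e} (hh : σ.Chosen h) (hm : σ.Chosen m) :
    σ.Chosen (h ≫ m) := by
  have key : ∀ (y : K.obj b ⟶ K.obj e), y = K.map h ≫ K.map m →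
      (⟨e, h ≫ m⟩ : Σ e : B, b ⟶ e) =
        ⟨σ.cleavage.cod b (S := A) y, σ.cleavage.lift b (S := A) y⟩ := by
    rintro _ rfl
    have h₀ := σ.cleavage.lift_comp (P := K.toFunctor) b (t := K.obj e) (K.map h)
    -- The axiom `lift_comp` concerns 1-cells out of `K` of the codomain of the cleavage's lift.
    -- Since `h` equals that lift only as a pair with its target, the axiom is transported along an
    -- equality of such pairs.
    have h₁ : ∀ (p : Σ e : B, b ⟶ e), p = ⟨d, h⟩ → ∀ {t : A} (v : K.obj p.1 ⟶ t)
        (v' : K.obj d ⟶ t), v ≍ v' →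
        (⟨σ.cleavage.cod b (S := A) (K.map p.2 ≫ v), σ.cleavage.lift b (S := A) (K.map p.2 ≫ v)⟩ :
          Σ e : B, b ⟶ e) = ⟨σ.cleavage.cod p.1 (S := A) v, p.2 ≫ σ.cleavage.lift p.1 (S := A) v⟩ →
        (⟨σ.cleavage.cod b (S := A) (K.map h ≫ v'), σ.cleavage.lift b (S := A) (K.map h ≫ v')⟩ :
          Σ e : B, b ⟶ e) =
            ⟨σ.cleavage.cod d (S := A) v', h ≫ σ.cleavage.lift d (S := A) v'⟩ := by
      rintro _ rfl t v _ ⟨⟩ H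
      exact H
    have h₂ : ∀ (p : Σ e : B, b ⟶ e), p = ⟨d, h⟩ → ∃ v : K.obj p.1 ⟶ K.obj e, v ≍ K.map m := by
      rintro _ rfl
      exact ⟨_, .rfl⟩
    obtain ⟨v, hv⟩ := h₂ _ (Eq.symm hh)
    have h₃ := h₁ _ (Eq.symm hh) v (K.map m) hv (h₀ v)
    have h₄ : ∀ (p : Σ e : B, d ⟶ e), ⟨e, m⟩ = p →
        (⟨e, h ≫ m⟩ : Σ e : B, b ⟶ e) = ⟨p.1, h ≫ p.2⟩ := by
      rintro _ rfl
      rfl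
    exact (h₄ _ hm).trans h₃.symm
  exact key _ (K.map_comp h m)

/-- Whiskering with `K t`, an identity up to transport, changes nothing, so the image of `δ` is a
2-cell into `K h` in disguise. Its lift to `h`, whiskered with `t`, has the same image as `δ` and so
equals `δ` by discreteness. -/
lemma exists_whiskerRight (σ : SplitDiscreteTwoOpfibration K) {b d e : B} {h : b ⟶ d} {t : d ⟶ e}
    (p : K.obj d = K.obj e) (ht : K.map t = eqToHom p) {k : b ⟶ e} (δ : k ⟶ h ≫ t) :
    ∃ (k' : b ⟶ d) (δ' : k' ⟶ h), (⟨k' ≫ t, δ' ▷ t⟩ : Σ y : b ⟶ e, y ⟶ h ≫ t) = ⟨k, δ⟩ := by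
  have key : ∀ {a a' : A} (p : a = a') (z : a ⟶ a') (_ : z = eqToHom p) (y : K.obj b ⟶ a)
      (x' : K.obj b ⟶ a') (ξ : x' ⟶ y ≫ z), ∃ (x : K.obj b ⟶ a) (ζ : x ⟶ y), ζ ▷ z ≐ ξ := by
    rintro a _ rfl z rfl y x' ξ
    refine ⟨x', ξ ≫ eqToHom (Strict.comp_id y), (Same.whisker_right_id _).trans ?_⟩
    exact (Same.comp_eqToHom_iff _ _ _).2 .refl
  obtain ⟨x, ζ, hζ⟩ := key p (K.map t) ht (K.map h) (K.map k) (K.map₂ δ ≫ eqToHom (K.map_comp h t))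
  have H : ∀ {k' : b ⟶ d} (δ' : k' ⟶ h), K.map₂ δ' ▷ K.map t ≐ K.map₂ δ →
      ∃ (k' : b ⟶ d) (δ' : k' ⟶ h), (⟨k' ≫ t, δ' ▷ t⟩ : Σ y : b ⟶ e, y ⟶ h ≫ t) = ⟨k, δ⟩ :=
    fun δ' hδ => ⟨_, δ', discrete_unique σ _ _ ((Same.map₂_whisker_right K δ' t).trans hδ)⟩
  exact ind₂ σ (motive := fun {x} ζ => ζ ▷ K.map t ≐ K.map₂ δ →
      ∃ (k' : b ⟶ d) (δ' : k' ⟶ h), (⟨k' ≫ t, δ' ▷ t⟩ : Σ y : b ⟶ e, y ⟶ h ≫ t) = ⟨k, δ⟩)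
    H ζ (by simpa using hζ)

variable (σ) in
/-- Factorizations of a 1-cell into a chosen lift followed by a vertical 1-cell. -/
structure Factorization {b e : B} (k : b ⟶ e) where
  obj : B
  left : b ⟶ obj
  right : obj ⟶ e
  chosen : σ.Chosen left
  eq : K.obj obj = K.obj e
  vertical : K.map right = eqToHom eq
  fac : left ≫ right = k

/-- The left factor is the chosen lift of `K k`; the universal property of this cocartesian arrow,
applied to `k` over an identity, supplies the vertical factor. -/
lemma nonempty_factorization {b e : B} (k : b ⟶ e) : Nonempty (σ.Factorization k) := by
  have h := σ.cleavage.isStronglyCocartesian b (S := A) (K.map k)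
  have hl := h.toIsHomLift
  have lift : K.toFunctor.IsHomLift (K.map k ≫ 𝟙 (K.obj e)) k := by
    rw [Strict.comp_id]
    exact .map k
  obtain ⟨t, ⟨ht, hf⟩, -⟩ :=
    @h.universal_property' _ (𝟙 (K.toFunctor.obj e)) k lift
  refine ⟨⟨_, _, t, lift_chosen _, isHomLift_codomain_eq hl, isHomLift_id ht _, hf⟩⟩

/-- The left factor has the same image as `k` up to transport, hence is determined as a chosen lift.
The right factor is then unique because the left one is cocartesian. -/
instance {b e : B} (k : b ⟶ e) : Subsingleton (σ.Factorization k) := by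
  refine ⟨?_⟩
  rintro ⟨d, h, t, hh, p, ht, fac⟩ ⟨d', h', t', hh', p', ht', fac'⟩
  have e₁ : K.map h ≍ K.map h' := by
    have a₁ : K.map h ≍ K.map k := by
      rw [← fac, K.map_comp, ht]
      exact (comp_eqToHom_heq (C := A) _ _).symm
    have a₂ : K.map h' ≍ K.map k := by
      rw [← fac', K.map_comp, ht']
      exact (comp_eqToHom_heq (C := A) _ _).symm
    exact a₁.trans a₂.symm
  cases chosen_lift_unique hh hh' (p.trans p'.symm) e₁
  have key : ∀ (q : Σ d : B, b ⟶ d), ⟨d, h⟩ = q → ∀ {s : A} (x : K.obj b ⟶ s),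
      K.toFunctor.IsStronglyCocartesian x q.2 →
      K.toFunctor.IsStronglyCocartesian x h := by
    rintro _ rfl s x H
    exact H
  have hc := key _ hh (K.map h) (σ.cleavage.isStronglyCocartesian b (S := A) (K.map h))
  have lift : K.toFunctor.IsHomLift (K.map h ≫ eqToHom p) k := by
    rw [← fac, ← ht, ← K.map_comp]
    exact .map _
  obtain ⟨_, _, hu⟩ := @hc.universal_property' _ (eqToHom p) k lift
  have lt : K.toFunctor.IsHomLift (eqToHom p) t := by
    rw [← ht]
    exact .map _
  have lt' : K.toFunctor.IsHomLift (eqToHom p) t' := by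
    rw [← ht']
    exact .map _
  have : t = t' := (hu t ⟨lt, fac⟩).trans (hu t' ⟨lt', fac'⟩).symm
  subst this
  rfl

/-- A choice of the factorization of a 1-cell into a chosen lift and a vertical 1-cell. -/
noncomputable def factorization {b e : B} (k : b ⟶ e) : σ.Factorization k :=
  Classical.choice (nonempty_factorization k)

end SplitDiscreteTwoOpfibration

end Lifts

end OplaxCartLax

namespace OplaxCartLax

/-! ### 2-functors of two variables with values in `Cat`, elementwise -/

section Elementwise

variable {A : Type u} [Bicategory.{w, v} A] [Strict A]
  {B : Type u₁} [Bicategory.{w₁, v₁} B] [Strict B]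
  (F : StrictPseudofunctor (Bᵒᵖ × A) Cat.{w₂, v₂})

/-- `F(f, id)` as a functor. -/
abbrev L {b b' : B} (f : b ⟶ b') (a : A) : F.obj (op b', a) ⥤ F.obj (op b, a) :=
  (mapL F f a).toFunctor

/-- `F(id, g)` as a functor. -/
abbrev R (b : B) {a a' : A} (g : a ⟶ a') : F.obj (op b, a) ⥤ F.obj (op b, a') :=
  (mapR F b g).toFunctor

/-- `F(δ, id)` as a natural transformation. -/
abbrev L₂ {b b' : B} {f f' : b ⟶ b'} (δ : f ⟶ f') (a : A) : L F f a ⟶ L F f' a :=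
  (map₂L F δ a).toNatTrans

/-- `F(id, γ)` as a natural transformation. -/
abbrev R₂ (b : B) {a a' : A} {g g' : a ⟶ a'} (γ : g ⟶ g') : R F b g ⟶ R F b g' :=
  (map₂R F b γ).toNatTrans

lemma L_id (b : B) (a : A) : L F (𝟙 b) a = 𝟭 _ := congrArg Cat.Hom.toFunctor (mapL_id F b a)

lemma R_id (b : B) (a : A) : R F b (𝟙 a) = 𝟭 _ := congrArg Cat.Hom.toFunctor (mapR_id F b a)

lemma L_comp {b b' b'' : B} (f : b ⟶ b') (f' : b' ⟶ b'') (a : A) :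
    L F (f ≫ f') a = L F f' a ⋙ L F f a := congrArg Cat.Hom.toFunctor (mapL_comp F f f' a)

lemma L_R {b b' : B} (f : b ⟶ b') {a a' : A} (g : a ⟶ a') :
    L F f a ⋙ R F b g = R F b' g ⋙ L F f a' := congrArg Cat.Hom.toFunctor (mapL_mapR F f g)

lemma L_id_obj {b : B} {a : A} (X : F.obj (op b, a)) : (L F (𝟙 b) a).obj X = X :=
  Functor.congr_obj (L_id F b a) X

lemma R_id_obj {b : B} {a : A} (X : F.obj (op b, a)) : (R F b (𝟙 a)).obj X = X :=
  Functor.congr_obj (R_id F b a) X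

lemma L_comp_obj {b b' b'' : B} (f : b ⟶ b') (f' : b' ⟶ b'') {a : A} (X : F.obj (op b'', a)) :
    (L F (f ≫ f') a).obj X = (L F f a).obj ((L F f' a).obj X) :=
  Functor.congr_obj (L_comp F f f' a) X

lemma L_R_obj {b b' : B} (f : b ⟶ b') {a a' : A} (g : a ⟶ a') (X : F.obj (op b', a)) :
    (R F b g).obj ((L F f a).obj X) = (L F f a').obj ((R F b' g).obj X) :=
  Functor.congr_obj (L_R F f g) X

lemma L_id_map {b : B} {a : A} {X Y : F.obj (op b, a)} (φ : X ⟶ Y) : (L F (𝟙 b) a).map φ ≐ φ :=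
  .functor (L_id F b a) φ

lemma R_id_map {b : B} {a : A} {X Y : F.obj (op b, a)} (φ : X ⟶ Y) : (R F b (𝟙 a)).map φ ≐ φ :=
  .functor (R_id F b a) φ

lemma L_comp_map {b b' b'' : B} (f : b ⟶ b') (f' : b' ⟶ b'') {a : A} {X Y : F.obj (op b'', a)}
    (φ : X ⟶ Y) : (L F (f ≫ f') a).map φ ≐ (L F f a).map ((L F f' a).map φ) :=
  .functor (L_comp F f f' a) φ

lemma L_R_map {b b' : B} (f : b ⟶ b') {a a' : A} (g : a ⟶ a') {X Y : F.obj (op b', a)}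
    (φ : X ⟶ Y) : (R F b g).map ((L F f a).map φ) ≐ (L F f a').map ((R F b' g).map φ) :=
  .functor (L_R F f g) φ

lemma L₂_id {b b' : B} (f : b ⟶ b') {a : A} (X : F.obj (op b', a)) : (L₂ F (𝟙 f) a).app X = 𝟙 _ :=
  congrArg (fun θ : mapL F f a ⟶ mapL F f a => θ.toNatTrans.app X) (F.map₂_id _)

lemma L₂_comp {b b' : B} {f f' f'' : b ⟶ b'} (δ : f ⟶ f') (δ' : f' ⟶ f'') {a : A}
    (X : F.obj (op b', a)) : (L₂ F (δ ≫ δ') a).app X = (L₂ F δ a).app X ≫ (L₂ F δ' a).app X := by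
  refine congrArg (fun θ : mapL F f a ⟶ mapL F f'' a => θ.toNatTrans.app X) (Eq.trans ?_
    (F.map₂_comp (a := (op b', a)) (b := (op b, a)) (Bicategory.Opposite.op2 δ ×ₘ 𝟙 (𝟙 a))
      (Bicategory.Opposite.op2 δ' ×ₘ 𝟙 (𝟙 a))))
  exact congrArg F.map₂ (Prod.ext rfl (Category.id_comp _).symm)

/-- Reversing 1-cells turns right whiskering in `B` into left whiskering in `Cat`, that is, into
evaluation at the image of an object under the whiskering functor. -/
lemma L₂_whiskerRight {b b' b'' : B} {f f' : b ⟶ b'} (δ : f ⟶ f') (g : b' ⟶ b'') {a : A}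
    (X : F.obj (op b'', a)) :
    (L₂ F (δ ▷ g) a).app X ≐ (L₂ F δ a).app ((L F g a).obj X) := by
  have h : map₂L F (δ ▷ g) a ≐ mapL F g a ◁ map₂L F δ a := by
    refine .trans (.map₂ F ?_)
      (Same.map₂_whisker_left F (a := (op b'', a)) (b := (op b', a)) (c := (op b, a)) _ _)
    exact .prod (a := op b'') (b := op b) (c := a) (d := a) .refl (Same.id_whisker_left _).symm
  exact h.toNatTrans_app X

lemma L₂_whiskerLeft {b b' b'' : B} (f : b ⟶ b') {g g' : b' ⟶ b''} (δ : g ⟶ g') {a : A}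
    (X : F.obj (op b'', a)) :
    (L₂ F (f ◁ δ) a).app X ≐ (L F f a).map ((L₂ F δ a).app X) := by
  have h : map₂L F (f ◁ δ) a ≐ map₂L F δ a ▷ mapL F f a := by
    refine .trans (.map₂ F ?_)
      (Same.map₂_whisker_right F (a := (op b'', a)) (b := (op b', a)) (c := (op b, a)) _ _)
    exact .prod (a := op b'') (b := op b) (c := a) (d := a) .refl (Same.whisker_right_id _).symm
  exact h.toNatTrans_app X

lemma L₂_R {b b' : B} {f f' : b ⟶ b'} (δ : f ⟶ f') {a a' : A} (g : a ⟶ a')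
    (X : F.obj (op b', a)) :
    (R F b g).map ((L₂ F δ a).app X) ≐ (L₂ F δ a').app ((R F b' g).obj X) := by
  have h : map₂L F δ a ▷ mapR F b g ≐ mapR F b' g ◁ map₂L F δ a' := by
    refine (Same.map₂_whisker_right F (a := (op b', a)) (b := (op b, a)) (c := (op b, a')) _
      _).symm.trans (.trans (.map₂ F ?_)
        (Same.map₂_whisker_left F (a := (op b', a)) (b := (op b', a')) (c := (op b, a')) _ _))
    refine .prod (a := op b') (b := op b) (c := a) (d := a') ?_ ?_
    · exact (Same.whisker_right_id _).trans (Same.id_whisker_left _).symm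
    · rw [id_whiskerRight, whiskerLeft_id]
      exact .id ((Strict.id_comp _).trans (Strict.comp_id _).symm)
  exact h.toNatTrans_app X

lemma R₂_L {b b' : B} (f : b ⟶ b') {a a' : A} {g g' : a ⟶ a'} (γ : g ⟶ g')
    (X : F.obj (op b', a)) :
    (R₂ F b γ).app ((L F f a).obj X) ≐ (L F f a').map ((R₂ F b' γ).app X) := by
  have h : mapL F f a ◁ map₂R F b γ ≐ map₂R F b' γ ▷ mapL F f a' := by
    refine (Same.map₂_whisker_left F (a := (op b', a)) (b := (op b, a)) (c := (op b, a')) _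
      _).symm.trans (.trans (.map₂ F ?_)
        (Same.map₂_whisker_right F (a := (op b', a)) (b := (op b', a')) (c := (op b, a')) _ _))
    refine .prod (a := op b') (b := op b) (c := a) (d := a') ?_ ?_
    · rw [id_whiskerRight, whiskerLeft_id]
      exact .id ((Strict.comp_id _).trans (Strict.id_comp _).symm)
    · exact (Same.id_whisker_left _).trans (Same.whisker_right_id _).symm
  exact h.toNatTrans_app X

end Elementwise

/-! ### The actions of A(K(-), -) as composition and whiskering. -/

section HomTwoFunctor

variable {A : Type u} [Bicategory.{w, v} A] [Strict A]
  {B : Type u₁} [Bicategory.{w₁, v₁} B] [Strict B]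
  (K : StrictPseudofunctor B A)

/-- The 2-functor always composes on both sides, so acting in one variable leaves a spurious
identity in the other; this and the next lemmas remove it. -/
lemma hom_L_obj {b b' : B} (f : b ⟶ b') {a : A} (x : K.obj b' ⟶ a) :
    (L (homTwoFunctor K) f a).obj x = K.map f ≫ x :=
  Strict.comp_id _

lemma hom_R_obj {b : B} {a a' : A} (g : a ⟶ a') (x : K.obj b ⟶ a) :
    (R (homTwoFunctor K) b g).obj x = x ≫ g := by
  change (K.map (𝟙 b) ≫ x) ≫ g = x ≫ g
  rw [K.map_id, Strict.id_comp]

lemma hom_L_map {b b' : B} (f : b ⟶ b') {a : A} {x y : K.obj b' ⟶ a} (ξ : x ⟶ y) :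
    Same (C := K.obj b ⟶ a) ((L (homTwoFunctor K) f a).map ξ) (K.map f ◁ ξ) :=
  Same.whisker_right_id _

lemma hom_R_map {b : B} {a a' : A} (g : a ⟶ a') {x y : K.obj b ⟶ a} (ξ : x ⟶ y) :
    Same (C := K.obj b ⟶ a') ((R (homTwoFunctor K) b g).map ξ) (ξ ▷ g) :=
  .whisker_right (.trans (.left_congr (K.map_id b) ξ) (.id_whisker_left ξ)) g

lemma hom_L₂ {b b' : B} {f f' : b ⟶ b'} (δ : f ⟶ f') {a : A} (x : K.obj b' ⟶ a) :
    Same (C := K.obj b ⟶ a) ((L₂ (homTwoFunctor K) δ a).app x) (K.map₂ δ ▷ x) := by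
  change (K.map₂ δ ▷ x) ▷ 𝟙 a ≫ (K.map f' ≫ x) ◁ 𝟙 (𝟙 a) ≐ _
  refine .trans (.of_eq ?_) (Same.whisker_right_id (K.map₂ δ ▷ x))
  exact (congrArg _ (whiskerLeft_id _ _)).trans (Category.comp_id _)

lemma hom_R₂ {b : B} {a a' : A} {g g' : a ⟶ a'} (γ : g ⟶ g') (x : K.obj b ⟶ a) :
    Same (C := K.obj b ⟶ a') ((R₂ (homTwoFunctor K) b γ).app x) (x ◁ γ) := by
  refine .trans (.of_eq (g := (K.map (𝟙 b) ≫ x) ◁ γ) ?_)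
    (.left_congr (by rw [K.map_id, Strict.id_comp]) γ)
  change (K.map₂ (𝟙 (𝟙 b)) ▷ x) ▷ g ≫ (K.map (𝟙 b) ≫ x) ◁ γ = _
  simp

end HomTwoFunctor

end OplaxCartLax

namespace OplaxCartLax

/-! ### Transformation axioms in `Cat`, read on components. -/

section CellsInCat

lemma Same.eq_iff {C : Type u} [Category.{v} C] {X Y : C} {f g : X ⟶ Y} : f = g ↔ f ≐ g :=
  ⟨.of_eq, Same.eq⟩

lemma Same.comm {C : Type u} [Category.{v} C] {X Y X' Y' : C} {f : X ⟶ Y} {g : X' ⟶ Y'} :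
    f ≐ g ↔ g ≐ f :=
  ⟨Same.symm, Same.symm⟩

lemma Comp.iff {C : Type u} [Category.{v} C] {X Y Z X' Z' : C} {f : X ⟶ Y} {g : Y ⟶ Z}
    {k : X' ⟶ Z'} : Comp f g k ↔ f ≫ g ≐ k := by
  simp [Comp]

lemma Same.iff_id {C : Type u} [Category.{v} C] {X Y Z W : C} {f : X ⟶ Y} (h : Z = W) :
    f ≐ 𝟙 Z ↔ f ≐ 𝟙 W := by
  subst h
  rfl

lemma hom₂_ext_iff {C D : Cat.{v, u}} {P Q : C ⟶ D} {θ τ : P ⟶ Q} :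
    θ = τ ↔ ∀ x : C, θ.toNatTrans.app x = τ.toNatTrans.app x :=
  ⟨fun h x => by rw [h], fun h => Cat.Hom₂.ext (NatTrans.ext (funext h))⟩

/-- If every component is an identity up to transport, the functors agree on objects, and the
naturality squares, with their identity sides cancelled, show that they agree on morphisms. -/
lemma exists_eq_eqToHom_iff {C D : Cat.{v, u}} {P Q : C ⟶ D} {θ : P ⟶ Q} :
    (∃ h, θ = eqToHom h) ↔ ∀ x : C, θ.toNatTrans.app x ≐ 𝟙 (P.toFunctor.obj x) := by
  constructor
  · rintro ⟨rfl, rfl⟩ x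
    exact .refl
  · intro H
    have h : P = Q := by
      refine Cat.Hom.ext (CategoryTheory.Functor.ext (fun x => (H x).target.symm) fun x y f => ?_)
      refine Same.eq ?_
      have := (Sq.app θ.toNatTrans f).comp (.of_right (H y) rfl .refl)
      simpa using (this.same_of_left (H x)).symm
    refine ⟨h, hom₂_ext_iff.2 fun x => ?_⟩
    subst h
    exact (H x).eq

variable {B : Type u₁} [Bicategory.{w₁, v₁} B] {C : Type u₂} [Bicategory.{w₂, v₂} C] [Strict C]
  [Strict B] {G H : StrictPseudofunctor (Bᵒᵖ × C) Cat.{w, v}}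
  (app : ∀ (b : B) (c : C), G.obj (op b, c) ⟶ H.obj (op b, c))
  (o : ∀ {b b' : B} (f : b ⟶ b') (c : C), mapL G f c ≫ app b c ⟶ app b' c ≫ mapL H f c)
  (l : ∀ (b : B) {c c' : C} (g : c ⟶ c'), app b c ≫ mapR H b g ⟶ mapR G b g ≫ app b c')

/-- This and the following equivalences take arbitrary cells rather than a given transformation, so
that they serve both to unpack one and to build one. Unitors and associators disappear on
components. -/
lemma oplaxCell_naturality_iff {b b' : B} {f f' : b ⟶ b'} (δ : f ⟶ f') (c : C) :
    map₂L G δ c ▷ app b c ≫ o f' c = o f c ≫ app b' c ◁ map₂L H δ c ↔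
      ∀ x : G.obj (op b', c), (app b c).toFunctor.map ((L₂ G δ c).app x) ≫
        (o f' c).toNatTrans.app x =
          (o f c).toNatTrans.app x ≫ (L₂ H δ c).app ((app b' c).toFunctor.obj x) :=
  hom₂_ext_iff

lemma oplaxCell_id_iff (b : B) (c : C) :
    o (𝟙 b) c ≫ app b c ◁ eqToHom (mapL_id H b c) =
      eqToHom (mapL_id G b c) ▷ app b c ≫ (λ_ (app b c)).hom ≫ (ρ_ (app b c)).inv ↔
      ∀ x, (o (𝟙 b) c).toNatTrans.app x ≐ 𝟙 ((app b c).toFunctor.obj x) := by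
  rw [hom₂_ext_iff]
  refine forall_congr' fun x => ?_
  rw [Same.eq_iff]
  simpa [Same.iff_eqToHom] using Same.iff_id (congrArg _ (L_id_obj G x))

lemma oplaxCell_comp_iff {b b' b'' : B} (f : b ⟶ b') (f' : b' ⟶ b'') (c : C) :
    o (f ≫ f') c ≫ app b'' c ◁ eqToHom (mapL_comp H f f' c) =
      eqToHom (mapL_comp G f f' c) ▷ app b c ≫ (α_ _ _ _).hom ≫
        mapL G f' c ◁ o f c ≫ (α_ _ _ _).inv ≫ o f' c ▷ mapL H f c ≫ (α_ _ _ _).hom ↔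
      ∀ x, Comp ((o f c).toNatTrans.app ((L G f' c).obj x))
        ((L H f c).map ((o f' c).toNatTrans.app x)) ((o (f ≫ f') c).toNatTrans.app x) := by
  rw [hom₂_ext_iff]
  refine forall_congr' fun x => ?_
  rw [Same.eq_iff, Same.comm]
  refine Iff.trans ?_ Comp.iff.symm
  simp

lemma laxCell_naturality_iff (b : B) {c c' : C} {g g' : c ⟶ c'} (δ : g ⟶ g') :
    l b g ≫ map₂R G b δ ▷ app b c' = app b c ◁ map₂R H b δ ≫ l b g' ↔
      ∀ x : G.obj (op b, c), (l b g).toNatTrans.app x ≫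
        (app b c').toFunctor.map ((R₂ G b δ).app x) =
          (R₂ H b δ).app ((app b c).toFunctor.obj x) ≫ (l b g').toNatTrans.app x :=
  hom₂_ext_iff

lemma laxCell_id_iff (b : B) (c : C) :
    l b (𝟙 c) ≫ eqToHom (mapR_id G b c) ▷ app b c =
      app b c ◁ eqToHom (mapR_id H b c) ≫ (ρ_ (app b c)).hom ≫ (λ_ (app b c)).inv ↔
      ∀ x, (l b (𝟙 c)).toNatTrans.app x ≐ 𝟙 ((app b c).toFunctor.obj x) := by
  rw [hom₂_ext_iff]
  refine forall_congr' fun x => ?_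
  rw [Same.eq_iff]
  simpa [Same.iff_eqToHom] using Same.iff_id (R_id_obj H _)

lemma laxCell_comp_iff (b : B) {c c' c'' : C} (g : c ⟶ c') (g' : c' ⟶ c'') :
    l b (g ≫ g') ≫ eqToHom (mapR_comp G b g g') ▷ app b c'' =
      app b c ◁ eqToHom (mapR_comp H b g g') ≫ (α_ _ _ _).inv ≫
        l b g ▷ mapR H b g' ≫ (α_ _ _ _).hom ≫
          mapR G b g ◁ l b g' ≫ (α_ _ _ _).inv ↔
      ∀ x, Comp ((R H b g').map ((l b g).toNatTrans.app x))
        ((l b g').toNatTrans.app ((R G b g).obj x)) ((l b (g ≫ g')).toNatTrans.app x) := by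
  rw [hom₂_ext_iff]
  refine forall_congr' fun x => ?_
  rw [Same.eq_iff, Same.comm]
  refine Iff.trans ?_ Comp.iff.symm
  simp

lemma Sq.iff {C : Type u} [Category.{v} C] {X Y Z X' Y' Z' : C} {f : X ⟶ Y} {g : Y ⟶ Z}
    {f' : X' ⟶ Y'} {g' : Y' ⟶ Z'} : Sq f g f' g' ↔ f ≫ g ≐ f' ≫ g' :=
  ⟨fun ⟨_, _, _, h, h'⟩ => (Comp.iff.1 h).trans (Comp.iff.1 h').symm,
    fun h => ⟨_, _, _, Comp.mk, Comp.mk.congr .refl .refl h.symm⟩⟩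

lemma Sq.iff_cast {C : Type u} [Category.{v} C] {X Y W Z X' Y' W' Z' : C} {f : X ⟶ Y} {g : W ⟶ Z}
    {f' : X' ⟶ Y'} {g' : W' ⟶ Z'} (p : Y = W) (q : Y' = W') :
    Sq f g f' g' ↔ f ≫ eqToHom p ≫ g ≐ f' ≫ eqToHom q ≫ g' := by
  subst p q
  simpa using Sq.iff

lemma compatibility_iff {b b' : B} (f : b ⟶ b') {c c' : C} (g : c ⟶ c') :
    mapL G f c ◁ l b g ≫ (α_ _ _ _).inv ≫ eqToHom (mapL_mapR G f g) ▷ app b c' ≫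
        (α_ _ _ _).hom ≫ mapR G b' g ◁ o f c' =
      (α_ _ _ _).inv ≫ o f c ▷ mapR H b g ≫ (α_ _ _ _).hom ≫
        app b' c ◁ eqToHom (mapL_mapR H f g) ≫ (α_ _ _ _).inv ≫
          l b' g ▷ mapL H f c' ≫ (α_ _ _ _).hom ↔
      ∀ x, Sq ((l b g).toNatTrans.app ((L G f c).obj x))
        ((o f c').toNatTrans.app ((R G b' g).obj x)) ((R H b g).map ((o f c).toNatTrans.app x))
        ((L H f c').map ((l b' g).toNatTrans.app x)) := by
  rw [hom₂_ext_iff]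
  refine forall_congr' fun x => ?_
  rw [Same.eq_iff]
  refine Iff.trans ?_ (Sq.iff_cast (congrArg (app b c').toFunctor.obj (L_R_obj G f g x))
    (L_R_obj H f g ((app b' c).toFunctor.obj x))).symm
  simp

end CellsInCat

end OplaxCartLax

namespace OplaxCartLax

/-! ### Oplax-cart-lax transformations out of A(K(-), -), elementwise. -/

section ElemTrans

variable {A : Type u} [Bicategory.{w, v} A] [Strict A]
  {B : Type u₁} [Bicategory.{w₁, v₁} B] [Strict B]
  {K : StrictPseudofunctor B A} (σ : SplitDiscreteTwoOpfibration K)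
  (F : StrictPseudofunctor (Bᵒᵖ × A) Cat.{w, v})

/-- Oplax-cart-lax natural transformations `A(K(-), -) ⟶ F`, elementwise. -/
structure ElemTrans where
  obj {b : B} {a : A} (x : K.obj b ⟶ a) : F.obj (op b, a)
  map {b : B} {a : A} {x y : K.obj b ⟶ a} (ξ : x ⟶ y) : obj x ⟶ obj y
  opl {b b' : B} (f : b ⟶ b') {a : A} (x : K.obj b' ⟶ a) :
    obj (K.map f ≫ x) ⟶ (L F f a).obj (obj x)
  lax {b : B} {a a' : A} (x : K.obj b ⟶ a) (g : a ⟶ a') : (R F b g).obj (obj x) ⟶ obj (x ≫ g)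
  map_id {b : B} {a : A} (x : K.obj b ⟶ a) : map (𝟙 x) = 𝟙 (obj x)
  map_comp {b : B} {a : A} {x y z : K.obj b ⟶ a} (ξ : x ⟶ y) (ζ : y ⟶ z) :
    map (ξ ≫ ζ) = map ξ ≫ map ζ
  opl_natural {b b' : B} (f : b ⟶ b') {a : A} {x y : K.obj b' ⟶ a} (ξ : x ⟶ y) :
    map (K.map f ◁ ξ) ≫ opl f y = opl f x ≫ (L F f a).map (map ξ)
  opl_map₂ {b b' : B} {f f' : b ⟶ b'} (δ : f ⟶ f') {a : A} (x : K.obj b' ⟶ a) :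
    map (K.map₂ δ ▷ x) ≫ opl f' x = opl f x ≫ (L₂ F δ a).app (obj x)
  opl_id {b : B} {a : A} (x : K.obj b ⟶ a) : opl (𝟙 b) x ≐ 𝟙 (obj x)
  opl_comp {b b' b'' : B} (f : b ⟶ b') (f' : b' ⟶ b'') {a : A} (x : K.obj b'' ⟶ a) :
    Comp (opl f (K.map f' ≫ x)) ((L F f a).map (opl f' x)) (opl (f ≫ f') x)
  opl_chosen {b b' : B} (f : b ⟶ b') (_ : σ.Chosen f) {a : A} (x : K.obj b' ⟶ a) :
    opl f x ≐ 𝟙 (obj (K.map f ≫ x))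
  lax_natural {b : B} {a a' : A} {x y : K.obj b ⟶ a} (ξ : x ⟶ y) (g : a ⟶ a') :
    (R F b g).map (map ξ) ≫ lax y g = lax x g ≫ map (ξ ▷ g)
  lax_map₂ {b : B} {a a' : A} (x : K.obj b ⟶ a) {g g' : a ⟶ a'} (γ : g ⟶ g') :
    lax x g ≫ map (x ◁ γ) = (R₂ F b γ).app (obj x) ≫ lax x g'
  lax_id {b : B} {a : A} (x : K.obj b ⟶ a) : lax x (𝟙 a) ≐ 𝟙 (obj x)
  lax_comp {b : B} {a a' a'' : A} (x : K.obj b ⟶ a) (g : a ⟶ a') (g' : a' ⟶ a'') :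
    Comp ((R F b g').map (lax x g)) (lax (x ≫ g) g') (lax x (g ≫ g'))
  compat {b b' : B} (f : b ⟶ b') {a a' : A} (x : K.obj b' ⟶ a) (g : a ⟶ a') :
    Sq (lax (K.map f ≫ x) g) (opl f (x ≫ g)) ((R F b g).map (opl f x))
      ((L F f a').map (lax x g))

namespace ElemTrans

variable {σ F}

lemma map_same (T : ElemTrans σ F) {b : B} {a : A} {x y x' y' : K.obj b ⟶ a} {ξ : x ⟶ y}
    {ξ' : x' ⟶ y'} (h : ξ ≐ ξ') : T.map ξ ≐ T.map ξ' := by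
  cases h
  exact .refl

lemma opl_same (T : ElemTrans σ F) {b b' : B} {f f' : b ⟶ b'} (hf : f = f') {a : A}
    {x y : K.obj b' ⟶ a} (h : x = y) : T.opl f x ≐ T.opl f' y := by
  subst h hf
  exact .refl

lemma lax_same (T : ElemTrans σ F) {b : B} {a a' : A} {x y : K.obj b ⟶ a} (h : x = y)
    {g g' : a ⟶ a'} (hg : g = g') : T.lax x g ≐ T.lax y g' := by
  subst h hg
  exact .refl

/-- The functor `A(K b, a) ⥤ F(b, a)`. -/
def functor (T : ElemTrans σ F) (b : B) (a : A) :
    (homTwoFunctor K).obj (op b, a) ⟶ F.obj (op b, a) :=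
  Cat.Hom.ofFunctor (C := (homTwoFunctor K).obj (op b, a))
    { obj := fun x : K.obj b ⟶ a => T.obj x
      map := fun ξ => T.map (x := _) (y := _) ξ
      map_id := T.map_id
      map_comp := T.map_comp }

lemma functor_map_same (T : ElemTrans σ F) {b : B} {a : A}
    {x y : (homTwoFunctor K).obj (op b, a)} (ξ : x ⟶ y) {x' y' : K.obj b ⟶ a} {ξ' : x' ⟶ y'}
    (h : Same (C := K.obj b ⟶ a) ξ ξ') : (T.functor b a).toFunctor.map ξ ≐ T.map ξ' :=
  T.map_same h

/-- The oplax structure cells. -/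
def oplaxCell (T : ElemTrans σ F) {b b' : B} (f : b ⟶ b') (a : A) :
    mapL (homTwoFunctor K) f a ≫ T.functor b a ⟶ T.functor b' a ≫ mapL F f a :=
  Cat.Hom₂.ofNatTrans
    { app := fun x : K.obj b' ⟶ a => eqToHom (congrArg T.obj (hom_L_obj K f x)) ≫ T.opl f x
      naturality := fun (x y : K.obj b' ⟶ a) ξ => by
        refine Sq.eq ((Sq.of_eq (T.opl_natural f ξ)).congr ?_ ?_ ?_ ?_)
        · exact (T.functor_map_same _ (hom_L_map K f ξ)).symm
        · exact (Same.iff_eqToHom_comp _ _ _).2 .refl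
        · exact (Same.iff_eqToHom_comp _ _ _).2 .refl
        · exact .refl }

/-- The lax structure cells. -/
def laxCell (T : ElemTrans σ F) (b : B) {a a' : A} (g : a ⟶ a') :
    T.functor b a ≫ mapR F b g ⟶ mapR (homTwoFunctor K) b g ≫ T.functor b a' :=
  Cat.Hom₂.ofNatTrans
    { app := fun x : K.obj b ⟶ a =>
        T.lax x g ≫ eqToHom (congrArg T.obj (hom_R_obj K g x).symm)
      naturality := fun (x y : K.obj b ⟶ a) ξ => by
        refine Sq.eq ((Sq.of_eq (T.lax_natural ξ g)).congr ?_ ?_ ?_ ?_)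
        · exact .refl
        · exact (Same.iff_comp_eqToHom _ _ _).2 .refl
        · exact (Same.iff_comp_eqToHom _ _ _).2 .refl
        · exact (T.functor_map_same _ (hom_R_map K g ξ)).symm }

lemma oplaxCell_app (T : ElemTrans σ F) {b b' : B} (f : b ⟶ b') (a : A) (x y : K.obj b' ⟶ a)
    (h : x = y) : (T.oplaxCell f a).toNatTrans.app x ≐ T.opl f y := by
  subst h
  exact (Same.eqToHom_comp_iff _ _ _).2 .refl

lemma laxCell_app (T : ElemTrans σ F) (b : B) {a a' : A} (g : a ⟶ a') (x y : K.obj b ⟶ a)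
    (h : x = y) : (T.laxCell b g).toNatTrans.app x ≐ T.lax y g := by
  subst h
  exact (Same.comp_eqToHom_iff _ _ _).2 .refl

/-- The oplax-cart-lax natural transformation given by elementwise data. -/
def toTrans (T : ElemTrans σ F) : OplaxCartLaxTrans σ (homTwoFunctor K) F where
  app := T.functor
  oplaxCell := T.oplaxCell
  laxCell := T.laxCell
  oplaxCell_naturality {b b' f f'} δ a := by
    refine (oplaxCell_naturality_iff _ T.oplaxCell δ a).2 fun (x : K.obj b' ⟶ a) => ?_
    refine Sq.eq ((Sq.of_eq (T.opl_map₂ δ x)).congr ?_ ?_ ?_ ?_)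
    · exact (T.functor_map_same _ (hom_L₂ K δ x)).symm
    · exact (T.oplaxCell_app _ _ _ _ rfl).symm
    · exact (T.oplaxCell_app _ _ _ _ rfl).symm
    · exact .refl
  oplaxCell_id b a := by
    refine (oplaxCell_id_iff _ T.oplaxCell b a).2 fun (x : K.obj b ⟶ a) => ?_
    exact (T.oplaxCell_app _ _ _ _ rfl).trans (T.opl_id x)
  oplaxCell_comp {b b' b''} f f' a := by
    refine (oplaxCell_comp_iff _ T.oplaxCell f f' a).2 fun (x : K.obj b'' ⟶ a) => ?_
    refine (T.opl_comp f f' x).congr ?_ ?_ ?_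
    · exact (T.oplaxCell_app _ _ _ _ (hom_L_obj K f' x)).symm
    · exact .map _ (T.oplaxCell_app _ _ _ _ rfl).symm
    · exact (T.oplaxCell_app _ _ _ _ rfl).symm
  oplaxCell_marked {b b'} f hf a := by
    refine exists_eq_eqToHom_iff.2 fun (x : K.obj b' ⟶ a) => ?_
    exact ((T.oplaxCell_app _ _ _ _ rfl).trans (T.opl_chosen f hf x)).trans
      (.id (congrArg T.obj (hom_L_obj K f x).symm))
  laxCell_naturality b {a a' g g'} γ := by
    refine (laxCell_naturality_iff _ T.laxCell b γ).2 fun (x : K.obj b ⟶ a) => ?_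
    refine Sq.eq ((Sq.of_eq (T.lax_map₂ x γ)).congr ?_ ?_ ?_ ?_)
    · exact (T.laxCell_app _ _ _ _ rfl).symm
    · exact (T.functor_map_same _ (hom_R₂ K γ x)).symm
    · exact .refl
    · exact (T.laxCell_app _ _ _ _ rfl).symm
  laxCell_id b a := by
    refine (laxCell_id_iff _ T.laxCell b a).2 fun (x : K.obj b ⟶ a) => ?_
    exact (T.laxCell_app _ _ _ _ rfl).trans (T.lax_id x)
  laxCell_comp b {a a' a''} g g' := by
    refine (laxCell_comp_iff _ T.laxCell b g g').2 fun (x : K.obj b ⟶ a) => ?_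
    refine (T.lax_comp x g g').congr ?_ ?_ ?_
    · exact .map _ (T.laxCell_app _ _ _ _ rfl).symm
    · exact (T.laxCell_app _ _ _ _ (hom_R_obj K g x)).symm
    · exact (T.laxCell_app _ _ _ _ rfl).symm
  compatibility {b b'} f {a a'} g := by
    refine (compatibility_iff _ T.oplaxCell T.laxCell f g).2 fun (x : K.obj b' ⟶ a) => ?_
    refine (T.compat f x g).congr ?_ ?_ ?_ ?_
    · exact (T.laxCell_app _ _ _ _ (hom_L_obj K f x)).symm
    · exact (T.oplaxCell_app _ _ _ _ (hom_R_obj K g x)).symm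
    · exact .map _ (T.oplaxCell_app _ _ _ _ rfl).symm
    · exact .map _ (T.laxCell_app _ _ _ _ rfl).symm

end ElemTrans

namespace OplaxCartLaxTrans

variable {σ F} (α : OplaxCartLaxTrans σ (homTwoFunctor K) F)

lemma app_map_same {b : B} {a : A} {x y x' y' : K.obj b ⟶ a} {ξ : x ⟶ y} {ξ' : x' ⟶ y'}
    (h : ξ ≐ ξ') : (α.app b a).toFunctor.map ξ ≐ (α.app b a).toFunctor.map ξ' := by
  cases h
  exact .refl

lemma app_obj_eq {b : B} {a : A} {x y : K.obj b ⟶ a} (h : x = y) :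
    (α.app b a).toFunctor.obj x = (α.app b a).toFunctor.obj y := by
  rw [h]

/-- The elementwise oplax structure. -/
def opl {b b' : B} (f : b ⟶ b') {a : A} (x : K.obj b' ⟶ a) :
    (α.app b a).toFunctor.obj (K.map f ≫ x) ⟶ (L F f a).obj ((α.app b' a).toFunctor.obj x) :=
  eqToHom (α.app_obj_eq (hom_L_obj K f x).symm) ≫ (α.oplaxCell f a).toNatTrans.app x

/-- The elementwise lax structure. -/
def lax {b : B} {a a' : A} (x : K.obj b ⟶ a) (g : a ⟶ a') :
    (R F b g).obj ((α.app b a).toFunctor.obj x) ⟶ (α.app b a').toFunctor.obj (x ≫ g) :=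
  (α.laxCell b g).toNatTrans.app x ≫ eqToHom (α.app_obj_eq (hom_R_obj K g x))

lemma opl_same {b b' : B} (f : b ⟶ b') {a : A} {x y : K.obj b' ⟶ a} (h : x = y) :
    (α.oplaxCell f a).toNatTrans.app x ≐ α.opl f y := by
  subst h
  exact (Same.iff_eqToHom_comp _ _ _).2 .refl

lemma lax_same {b : B} {a a' : A} (g : a ⟶ a') {x y : K.obj b ⟶ a} (h : x = y) :
    (α.laxCell b g).toNatTrans.app x ≐ α.lax y g := by
  subst h
  exact (Same.iff_comp_eqToHom _ _ _).2 .refl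

/-- The elementwise data of an oplax-cart-lax natural transformation. -/
def toElem : ElemTrans σ F where
  obj {b a} x := (α.app b a).toFunctor.obj x
  map {b a} _ _ ξ := (α.app b a).toFunctor.map ξ
  opl := α.opl
  lax := α.lax
  map_id x := (α.app _ _).toFunctor.map_id _
  map_comp ξ ζ := (α.app _ _).toFunctor.map_comp _ _
  opl_natural f a x y ξ := by
    refine Sq.eq ((Sq.app (α.oplaxCell f a).toNatTrans ξ).congr ?_ ?_ ?_ ?_)
    · exact α.app_map_same (hom_L_map K f ξ)
    · exact α.opl_same f rfl
    · exact α.opl_same f rfl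
    · exact .refl
  opl_map₂ δ a x := by
    refine Sq.eq ((Sq.of_eq ((oplaxCell_naturality_iff _ α.oplaxCell δ a).1
      (α.oplaxCell_naturality δ a) x)).congr ?_ ?_ ?_ ?_)
    · exact α.app_map_same (hom_L₂ K δ x)
    · exact α.opl_same _ rfl
    · exact α.opl_same _ rfl
    · exact .refl
  opl_id x := (α.opl_same _ rfl).symm.trans
    ((oplaxCell_id_iff _ α.oplaxCell _ _).1 (α.oplaxCell_id _ _) x)
  opl_comp f f' a x :=
    ((oplaxCell_comp_iff _ α.oplaxCell f f' a).1 (α.oplaxCell_comp f f' a) x).congr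
      (α.opl_same _ (hom_L_obj K f' x)) (.map _ (α.opl_same _ rfl)) (α.opl_same _ rfl)
  opl_chosen f hf a x := (α.opl_same _ rfl).symm.trans
    ((exists_eq_eqToHom_iff.1 (α.oplaxCell_marked f hf a) x).trans
      (.id (α.app_obj_eq (hom_L_obj K f x))))
  lax_natural {b a a'} x y ξ g := by
    refine Sq.eq ((Sq.app (α.laxCell b g).toNatTrans ξ).congr ?_ ?_ ?_ ?_)
    · exact .refl
    · exact α.lax_same g rfl
    · exact α.lax_same g rfl
    · exact α.app_map_same (hom_R_map K g ξ)
  lax_map₂ {b a a'} x g g' γ := by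
    refine Sq.eq ((Sq.of_eq ((laxCell_naturality_iff _ α.laxCell b γ).1
      (α.laxCell_naturality b γ) x)).congr ?_ ?_ ?_ ?_)
    · exact α.lax_same _ rfl
    · exact α.app_map_same (hom_R₂ K γ x)
    · exact .refl
    · exact α.lax_same _ rfl
  lax_id x := (α.lax_same _ rfl).symm.trans
    ((laxCell_id_iff _ α.laxCell _ _).1 (α.laxCell_id _ _) x)
  lax_comp x g g' :=
    ((laxCell_comp_iff _ α.laxCell _ g g').1 (α.laxCell_comp _ g g') x).congr
      (.map _ (α.lax_same _ rfl)) (α.lax_same _ (hom_R_obj K g x)) (α.lax_same _ rfl)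
  compat f a a' x g :=
    ((compatibility_iff _ α.oplaxCell α.laxCell f g).1 (α.compatibility f g) x).congr
      (α.lax_same _ (hom_L_obj K f x)) (α.opl_same _ (hom_R_obj K g x))
      (.map _ (α.opl_same _ rfl)) (.map _ (α.lax_same _ rfl))

end OplaxCartLaxTrans

end ElemTrans

end OplaxCartLax

namespace OplaxCartLax

/-! ### Extraordinary transformations elementwise, and evaluation at identities. -/

section ElemExtra

variable {A : Type u} [Bicategory.{w, v} A] [Strict A]
  {B : Type u₁} [Bicategory.{w₁, v₁} B] [Strict B]
  {K : StrictPseudofunctor B A}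
  {F : StrictPseudofunctor (Bᵒᵖ × A) Cat.{w, v}}

variable (K F) in
/-- Extraordinary lax natural transformations `1 ⟶ F(b, K b)`, elementwise. -/
structure ElemExtra where
  obj (b : B) : F.obj (op b, K.obj b)
  cell {b b' : B} (f : b ⟶ b') :
    (R F b (K.map f)).obj (obj b) ⟶ (L F f (K.obj b')).obj (obj b')
  cell_map₂ {b b' : B} {f f' : b ⟶ b'} (δ : f ⟶ f') :
    cell f ≫ (L₂ F δ (K.obj b')).app (obj b') = (R₂ F b (K.map₂ δ)).app (obj b) ≫ cell f'
  cell_id (b : B) : cell (𝟙 b) ≐ 𝟙 (obj b)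
  cell_comp {b b' b'' : B} (f : b ⟶ b') (f' : b' ⟶ b'') :
    Comp ((R F b (K.map f')).map (cell f)) ((L F f (K.obj b'')).map (cell f')) (cell (f ≫ f'))

/-- The object of the chosen terminal category. -/
def star : Cat.chosenTerminal.{w, v} := ⟨⟨()⟩⟩

lemma hom₂_star_ext_iff {D : Cat.{w, v}} {P Q : Cat.chosenTerminal.{w, v} ⟶ D} {θ τ : P ⟶ Q} :
    θ = τ ↔ θ.toNatTrans.app star = τ.toNatTrans.app star :=
  hom₂_ext_iff.trans ⟨fun h => h star, fun h _ => h⟩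

lemma hom_star_ext {D : Cat.{w, v}} {P Q : Cat.chosenTerminal.{w, v} ⟶ D}
    (h : P.toFunctor.obj star = Q.toFunctor.obj star) : P = Q :=
  Cat.Hom.ext (Cat.fromChosenTerminalEquiv.injective h)

namespace ExtraordinaryLaxData

variable (D : ExtraordinaryLaxData K Cat.chosenTerminal.{w, v} F)

/-- The component at `b`, as an object of `F(b, K b)`. -/
abbrev pt (b : B) : F.obj (op b, K.obj b) := (D.app b).toFunctor.obj star

/-- The structure cell at `f`, as a morphism of `F(b, K b')`. -/
abbrev arrow {b b' : B} (f : b ⟶ b') :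
    (R F b (K.map f)).obj (D.pt b) ⟶ (L F f (K.obj b')).obj (D.pt b') :=
  (D.cell f).toNatTrans.app star

lemma cell_naturality_iff {b b' : B} {f f' : b ⟶ b'} (δ : f ⟶ f') :
    D.cell f ≫ D.app b' ◁ map₂L F δ (K.obj b') =
      D.app b ◁ map₂R F b (K.map₂ δ) ≫ D.cell f' ↔
    D.arrow f ≫ (L₂ F δ (K.obj b')).app (D.pt b') =
      (R₂ F b (K.map₂ δ)).app (D.pt b) ≫ D.arrow f' :=
  hom₂_star_ext_iff

lemma cell_id_iff (b : B) (h : mapR F b (K.map (𝟙 b)) = mapL F (𝟙 b) (K.obj b)) :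
    D.cell (𝟙 b) = D.app b ◁ eqToHom h ↔ D.arrow (𝟙 b) ≐ 𝟙 (D.pt b) := by
  -- The componentwise computation works for any functor `P` and any object of its source; only
  -- afterwards is it specialised to the terminal category.
  have key : ∀ {X : Cat.{w, v}} (P : X ⟶ F.obj (op b, K.obj b)) (θ : P ≫ mapR F b (K.map (𝟙 b)) ⟶
      P ≫ mapL F (𝟙 b) (K.obj b)) (x : X),
      θ.toNatTrans.app x = (P ◁ eqToHom h).toNatTrans.app x ↔
        θ.toNatTrans.app x ≐ 𝟙 (P.toFunctor.obj x) := by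
    intro X P θ x
    have e : (R F b (K.map (𝟙 b))).obj (P.toFunctor.obj x) = P.toFunctor.obj x := by
      rw [K.map_id, R_id_obj]
    rw [Same.eq_iff, ← Same.iff_id e]
    simp [Same.iff_eqToHom]
  exact hom₂_star_ext_iff.trans (key (D.app b) (D.cell (𝟙 b)) star)

lemma cell_comp_iff {b b' b'' : B} (f : b ⟶ b') (f' : b' ⟶ b'')
    (h : mapR F b (K.map (f ≫ f')) = mapR F b (K.map f) ≫ mapR F b (K.map f')) :
    D.cell (f ≫ f') =
      D.app b ◁ eqToHom h ≫ (α_ _ _ _).inv ≫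
        D.cell f ▷ mapR F b (K.map f') ≫ (α_ _ _ _).hom ≫
          D.app b' ◁ eqToHom (mapL_mapR F f (K.map f')) ≫ (α_ _ _ _).inv ≫
            D.cell f' ▷ mapL F f (K.obj b'') ≫ (α_ _ _ _).hom ≫
              D.app b'' ◁ eqToHom (mapL_comp F f f' (K.obj b'')).symm ↔
    Comp ((R F b (K.map f')).map (D.arrow f)) ((L F f (K.obj b'')).map (D.arrow f'))
      (D.arrow (f ≫ f')) := by
  have key : ∀ {X : Cat.{w, v}} (P : X ⟶ F.obj (op b, K.obj b)) (P' : X ⟶ F.obj (op b', K.obj b'))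
      (P'' : X ⟶ F.obj (op b'', K.obj b''))
      (θ : P ≫ mapR F b (K.map f) ⟶ P' ≫ mapL F f (K.obj b'))
      (θ' : P' ≫ mapR F b' (K.map f') ⟶ P'' ≫ mapL F f' (K.obj b''))
      (θ'' : P ≫ mapR F b (K.map (f ≫ f')) ⟶ P'' ≫ mapL F (f ≫ f') (K.obj b'')) (x : X),
      θ''.toNatTrans.app x = (P ◁ eqToHom h ≫ (α_ _ _ _).inv ≫ θ ▷ mapR F b (K.map f') ≫
        (α_ _ _ _).hom ≫ P' ◁ eqToHom (mapL_mapR F f (K.map f')) ≫ (α_ _ _ _).inv ≫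
          θ' ▷ mapL F f (K.obj b'') ≫ (α_ _ _ _).hom ≫
            P'' ◁ eqToHom (mapL_comp F f f' (K.obj b'')).symm).toNatTrans.app x ↔
      Comp ((R F b (K.map f')).map (θ.toNatTrans.app x))
        ((L F f (K.obj b'')).map (θ'.toNatTrans.app x)) (θ''.toNatTrans.app x) := by
    intro X P P' P'' θ θ' θ'' x
    rw [Same.eq_iff, Same.comm]
    refine Iff.trans ?_
      ⟨fun h => ⟨L_R_obj F f (K.map f') (P'.toFunctor.obj x), h⟩, fun h => h.2⟩
    rw [← Same.comp_eqToHom_iff (p := (L_comp_obj F f f' (P''.toFunctor.obj x)).symm)]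
    simp
  exact hom₂_star_ext_iff.trans (key (D.app b) (D.app b') (D.app b'') (D.cell f) (D.cell f')
    (D.cell (f ≫ f')) star)

end ExtraordinaryLaxData

/-- The elementwise data of an extraordinary lax natural transformation. -/
def ExtraordinaryLaxTrans.toElem (η : ExtraordinaryLaxTrans K Cat.chosenTerminal.{w, v} F) :
    ElemExtra K F where
  obj := η.pt
  cell := η.arrow
  cell_map₂ δ := (η.cell_naturality_iff δ).1 (η.cell_naturality δ)
  cell_id b := (η.cell_id_iff b _).1 (η.cell_id b)
  cell_comp f f' := (η.cell_comp_iff f f' _).1 (η.cell_comp f f')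

namespace ElemTrans

variable {σ : SplitDiscreteTwoOpfibration K} (T : ElemTrans σ F)

/-- Evaluation at identities: the objects. -/
abbrev pt (b : B) : F.obj (op b, K.obj b) := T.obj (𝟙 (K.obj b))

/-- Evaluation at identities: the structure cells. -/
def arrow {b b' : B} (f : b ⟶ b') :
    (R F b (K.map f)).obj (T.pt b) ⟶ (L F f (K.obj b')).obj (T.pt b') :=
  T.lax (𝟙 (K.obj b)) (K.map f) ≫
    eqToHom (congrArg T.obj ((Strict.id_comp _).trans (Strict.comp_id _).symm)) ≫
      T.opl f (𝟙 (K.obj b'))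

lemma arrow_comp {b b' : B} (f : b ⟶ b') :
    Comp (T.lax (𝟙 (K.obj b)) (K.map f)) (T.opl f (𝟙 (K.obj b'))) (T.arrow f) :=
  .mk_cast _

/-- The 2-cell slides first across the oplax cell and then across the lax cell. The passage between
the two is possible because whiskering `K δ` with an identity on either side gives the same 2-cell.
-/
lemma arrow_map₂ {b b' : B} {f f' : b ⟶ b'} (δ : f ⟶ f') :
    T.arrow f ≫ (L₂ F δ (K.obj b')).app (T.pt b') =
      (R₂ F b (K.map₂ δ)).app (T.pt b) ≫ T.arrow f' := by
  have h₁ := Sq.of_eq (T.opl_map₂ δ (𝟙 (K.obj b')))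
  have h₂ := Sq.of_eq (T.lax_map₂ (𝟙 (K.obj b)) (K.map₂ δ))
  have h₃ : T.map (𝟙 (K.obj b) ◁ K.map₂ δ) ≐ T.map (K.map₂ δ ▷ 𝟙 (K.obj b')) :=
    T.map_same ((Same.id_whisker_left _).trans (Same.whisker_right_id _).symm)
  obtain ⟨_, _, w, hw, hw'⟩ := h₂
  obtain ⟨_, _, u, hu, hu'⟩ := h₁
  obtain ⟨z, hz, hz'⟩ := (T.arrow_comp f).exists_assoc hu'
  exact (hz.sq (hw'.assoc ((hw.congr .refl h₃ .refl).assoc' hu hz') (T.arrow_comp f'))).eq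

lemma arrow_id (b : B) : T.arrow (𝟙 b) ≐ 𝟙 (T.pt b) := by
  have h := (T.lax_same rfl (K.map_id b)).trans (T.lax_id (𝟙 (K.obj b)))
  exact ((T.arrow_comp (𝟙 b)).same_of_left h).symm.trans (T.opl_id _)

/-- Expanding the lax and the oplax cell of the composite gives four factors; the compatibility
axiom at the identity of `K b'` interchanges the middle two and leaves the evaluations at `f` and
`f'`. -/
lemma arrow_comp_comp {b b' b'' : B} (f : b ⟶ b') (f' : b' ⟶ b'') :
    Comp ((R F b (K.map f')).map (T.arrow f)) ((L F f (K.obj b'')).map (T.arrow f'))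
      (T.arrow (f ≫ f')) :=
  Comp.interchange (T.lax_comp _ _ _) (T.opl_comp f f' _)
    ((T.arrow_comp (f ≫ f')).congr (T.lax_same rfl (K.map_comp f f')) .refl .refl)
    ((T.compat f (𝟙 (K.obj b')) (K.map f')).congr
      (T.lax_same ((Strict.comp_id _).trans (Strict.id_comp _).symm) rfl)
      (T.opl_same rfl ((Strict.id_comp _).trans (Strict.comp_id _).symm)) .refl .refl)
    ((T.arrow_comp f).map _) ((T.arrow_comp f').map _)

end ElemTrans

lemma evalId_arrow {σ : SplitDiscreteTwoOpfibration K}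
    (α : OplaxCartLaxTrans σ (homTwoFunctor K) F) {b b' : B} (f : b ⟶ b') :
    (evalId α).arrow f = α.toElem.arrow f := by
  refine Same.eq (Comp.same ?_ (α.toElem.arrow_comp f))
  have key : ∀ {X : Cat.{w, v}} (P : X ⟶ (homTwoFunctor K).obj (op b, K.obj b))
      (P' : X ⟶ (homTwoFunctor K).obj (op b', K.obj b'))
      (h : P ≫ mapR (homTwoFunctor K) b (K.map f) =
        P' ≫ mapL (homTwoFunctor K) f (K.obj b')) (x : X),
      Comp ((α.laxCell b (K.map f)).toNatTrans.app (P.toFunctor.obj x))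
        ((α.oplaxCell f (K.obj b')).toNatTrans.app (P'.toFunctor.obj x))
        (((α_ _ _ _).hom ≫ P ◁ α.laxCell b (K.map f) ≫ (α_ _ _ _).inv ≫
          eqToHom h ▷ α.app b (K.obj b') ≫ (α_ _ _ _).hom ≫
            P' ◁ α.oplaxCell f (K.obj b') ≫ (α_ _ _ _).inv).toNatTrans.app x) := by
    intro X P P' h x
    have e : (P ≫ mapR (homTwoFunctor K) b (K.map f)).toFunctor.obj x =
      (P' ≫ mapL (homTwoFunctor K) f (K.obj b')).toFunctor.obj x := by rw [h]
    refine ⟨congrArg (α.app b (K.obj b')).toFunctor.obj e, .of_eq ?_⟩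
    simp
  have h : Comp ((α.laxCell b (K.map f)).toNatTrans.app (𝟙 (K.obj b)))
      ((α.oplaxCell f (K.obj b')).toNatTrans.app (𝟙 (K.obj b'))) ((evalId α).arrow f) :=
    key (pickId K b) (pickId K b') (pickId_mapR K f) star
  exact h.congr (α.lax_same _ rfl) (α.opl_same _ rfl) .refl

/-- Evaluation at identities, on objects. -/
def evalTrans {σ : SplitDiscreteTwoOpfibration K}
    (α : OplaxCartLaxTrans σ (homTwoFunctor K) F) :
    ExtraordinaryLaxTrans K Cat.chosenTerminal.{w, v} F where
  __ := evalId α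
  cell_naturality δ := by
    refine ((evalId α).cell_naturality_iff δ).2 ?_
    rw [evalId_arrow, evalId_arrow]
    exact α.toElem.arrow_map₂ δ
  cell_id b := by
    refine ((evalId α).cell_id_iff b _).2 ?_
    rw [evalId_arrow]
    exact α.toElem.arrow_id b
  cell_comp f f' := by
    refine ((evalId α).cell_comp_iff f f' _).2 ?_
    rw [evalId_arrow, evalId_arrow, evalId_arrow]
    exact α.toElem.arrow_comp_comp f f'

end ElemExtra

end OplaxCartLax

namespace OplaxCartLax

open SplitDiscreteTwoOpfibration

/-! ### Existence: extending an extraordinary transformation. -/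

section Extension

variable {A : Type u} [Bicategory.{w, v} A] [Strict A]
  {B : Type u₁} [Bicategory.{w₁, v₁} B] [Strict B]
  {K : StrictPseudofunctor B A} (σ : SplitDiscreteTwoOpfibration K)
  {F : StrictPseudofunctor (Bᵒᵖ × A) Cat.{w, v}} (E : ElemExtra K F)

namespace ElemExtra

/-- The extension of an extraordinary transformation to all 1-cells `x : K b ⟶ a`. -/
noncomputable def ext {b : B} {a : A} (x : K.obj b ⟶ a) : F.obj (op b, a) :=
  σ.rec₁ (motive := fun {a} _ => F.obj (op b, a))
    (fun {d} h _ => (L F h (K.obj d)).obj (E.obj d)) x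

lemma ext_map {b d : B} {h : b ⟶ d} (hh : σ.Chosen h) :
    E.ext σ (K.map h) = (L F h (K.obj d)).obj (E.obj d) :=
  rec₁_map _ h hh

/-- Meant for `z = K t` with `t` vertical: with it the extension can be computed at `K h ≫ K t`
although `h ≫ t` need not be chosen. -/
lemma ext_comp_eqToHom {b : B} {a a' : A} (x : K.obj b ⟶ a) (p : a = a') {z : a ⟶ a'}
    (hz : z = eqToHom p) : E.ext σ (x ≫ z) = (R F b z).obj (E.ext σ x) := by
  subst p hz
  rw [eqToHom_refl, R_id_obj, Strict.comp_id]

lemma ext_factorization {b e : B} {k : b ⟶ e} (φ : σ.Factorization k) :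
    E.ext σ (K.map k) = (L F φ.left _).obj ((R F _ (K.map φ.right)).obj (E.obj φ.obj)) := by
  rw [← L_R_obj, ← E.ext_map σ φ.chosen, ← E.ext_comp_eqToHom σ _ φ.eq φ.vertical, ← K.map_comp,
    φ.fac]

/-- The comparison morphism between the extension at `K k` and the image under `F(k, id)`. -/
noncomputable def comparison {b e : B} (k : b ⟶ e) :
    E.ext σ (K.map k) ⟶ (L F k (K.obj e)).obj (E.obj e) :=
  eqToHom (E.ext_factorization σ (factorization k)) ≫
    (L F (factorization k).left _).map (E.cell (factorization k).right) ≫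
      eqToHom (by rw [← L_comp_obj, (factorization k).fac])

/-- Factorizations are unique, so the comparison may be computed from whichever one is at hand. -/
lemma comparison_factorization {b e : B} {k : b ⟶ e} (φ : σ.Factorization k) :
    E.comparison σ k ≐ (L F φ.left _).map (E.cell φ.right) := by
  rw [Subsingleton.elim φ (factorization k), comparison]
  simpa using .refl

lemma comparison_same {b e : B} {k k' : b ⟶ e} (h : k = k') :
    E.comparison σ k ≐ E.comparison σ k' := by
  subst h
  exact .refl

/-- A chosen `k` factors as itself followed by an identity, where the extraordinary cell is trivial.
This is the source of the cartesian marking of the extension. -/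
lemma comparison_chosen {b e : B} {k : b ⟶ e} (hk : σ.Chosen k) :
    E.comparison σ k ≐ 𝟙 (E.ext σ (K.map k)) := by
  refine (E.comparison_factorization σ
    ⟨e, k, 𝟙 e, hk, rfl, K.map_id e, Strict.comp_id k⟩).trans ?_
  refine (Same.map _ (E.cell_id e)).trans ?_
  rw [CategoryTheory.Functor.map_id]
  exact .id (E.ext_map σ hk).symm

/-- If `k = h ≫ s`, then `k ≫ t` has the same chosen part `h` and vertical part `s ≫ t`, so the
claim is the image under F(h, id) of the composition axiom for `s` and `t`. -/
lemma comparison_comp_vertical {b d e : B} (k : b ⟶ d) (t : d ⟶ e) (p : K.obj d = K.obj e)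
    (ht : K.map t = eqToHom p) :
    Comp ((R F b (K.map t)).map (E.comparison σ k)) ((L F k (K.obj e)).map (E.cell t))
      (E.comparison σ (k ≫ t)) := by
  obtain ⟨c, h, s, hh, q, hs, rfl⟩ := factorization (σ := σ) k
  have h₁ := E.comparison_factorization σ ⟨c, h, s, hh, q, hs, rfl⟩
  have h₂ := E.comparison_factorization σ ⟨c, h, s ≫ t, hh, q.trans p,
    by rw [K.map_comp, hs, ht]; exact eqToHom_trans (C := A) _ _, (Strict.assoc h s t).symm⟩
  refine ((E.cell_comp s t).map (L F h (K.obj e))).congr ?_ ?_ h₂.symm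
  · exact (L_R_map F _ _ _).symm.trans (.map _ h₁.symm)
  · exact (L_comp_map F _ _ _).symm

/-- The extension on 2-cells. -/
noncomputable def extMap {b : B} {a : A} {x y : K.obj b ⟶ a} (ξ : x ⟶ y) :
    E.ext σ x ⟶ E.ext σ y :=
  σ.rec₂ (motive := fun {_ x y} _ => E.ext σ x ⟶ E.ext σ y)
    (fun {d k' _} hk δ => E.comparison σ k' ≫ (L₂ F δ (K.obj d)).app (E.obj d) ≫
      eqToHom (E.ext_map σ hk).symm) ξ

lemma extMap_map₂ {b d : B} {k' k : b ⟶ d} (hk : σ.Chosen k) (δ : k' ⟶ k) :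
    Comp (E.comparison σ k') ((L₂ F δ (K.obj d)).app (E.obj d)) (E.extMap σ (K.map₂ δ)) := by
  rw [extMap, rec₂_map _ hk]
  refine Comp.iff.2 ?_
  simpa using .refl

lemma extMap_same {b : B} {a : A} {x y x' y' : K.obj b ⟶ a} {ξ : x ⟶ y} {ξ' : x' ⟶ y'}
    (h : ξ ≐ ξ') : E.extMap σ ξ ≐ E.extMap σ ξ' := by
  cases h
  exact .refl

lemma extMap_whiskerRight_eqToHom {b : B} {a a' : A} {x y : K.obj b ⟶ a} (ξ : x ⟶ y) (p : a = a')
    {z : a ⟶ a'} (hz : z = eqToHom p) :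
    E.extMap σ (ξ ▷ z) ≐ (R F b z).map (E.extMap σ ξ) := by
  subst p hz
  exact (E.extMap_same σ (Same.whisker_right_id ξ)).trans (R_id_map F _).symm

/-- For chosen `k` this is the definition, the comparison at `k` being an identity. In general, with
`k = h ≫ t`, the 2-cell is some `δ'` into `h` whiskered with `t`; the square for `δ'` is pasted with
naturality of F(δ', id) at the cell of `t`. -/
lemma extMap_comparison {b e : B} {k' k : b ⟶ e} (δ : k' ⟶ k) :
    Sq (E.extMap σ (K.map₂ δ)) (E.comparison σ k) (E.comparison σ k')
      ((L₂ F δ (K.obj e)).app (E.obj e)) := by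
  obtain ⟨d, h, t, hh, p, ht, rfl⟩ := factorization (σ := σ) k
  obtain ⟨k'', δ', hδ⟩ := exists_whiskerRight σ p ht δ
  cases hδ
  have h₁ : E.extMap σ (K.map₂ (δ' ▷ t)) ≐ (R F b (K.map t)).map (E.extMap σ (K.map₂ δ')) :=
    (E.extMap_same σ (Same.map₂_whisker_right K δ' t)).trans
      (E.extMap_whiskerRight_eqToHom σ _ p ht)
  have h₂ := ((E.extMap_map₂ σ hh δ').map (R F b (K.map t))).congr .refl (L₂_R F δ' _ _) h₁.symm
  have h₃ := (Sq.app (L₂ F δ' (K.obj e)) (E.cell t)).symm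
  have h₄ := E.comparison_factorization σ ⟨d, h, t, hh, p, ht, rfl⟩
  exact Sq.paste h₂ (h₃.congr .refl h₄.symm .refl (L₂_whiskerRight F δ' t (E.obj e)).symm)
    (E.comparison_comp_vertical σ k'' t p ht)

/-- The oplax structure of the extension. -/
noncomputable def extOpl {b b' : B} (f : b ⟶ b') {a : A} (x : K.obj b' ⟶ a) :
    E.ext σ (K.map f ≫ x) ⟶ (L F f a).obj (E.ext σ x) :=
  σ.rec₁ (motive := fun {a} x => E.ext σ (K.map f ≫ x) ⟶ (L F f a).obj (E.ext σ x))
    (fun h hh => eqToHom (by rw [K.map_comp]) ≫ E.comparison σ (f ≫ h) ≫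
      eqToHom (by rw [L_comp_obj, E.ext_map σ hh])) x

lemma extOpl_map {b b' d : B} (f : b ⟶ b') {h : b' ⟶ d} (hh : σ.Chosen h) :
    E.extOpl σ f (K.map h) ≐ E.comparison σ (f ≫ h) := by
  rw [extOpl, rec₁_map _ h hh]
  simpa using .refl

lemma extOpl_same {b b' : B} {f f' : b ⟶ b'} (hf : f = f') {a : A} {x x' : K.obj b' ⟶ a}
    (hx : x = x') : E.extOpl σ f x ≐ E.extOpl σ f' x' := by
  subst hf hx
  exact .refl

lemma extOpl_comp_eqToHom {b b' : B} (f : b ⟶ b') {a a' : A} (x : K.obj b' ⟶ a) (p : a = a')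
    {z : a ⟶ a'} (hz : z = eqToHom p) :
    E.extOpl σ f (x ≫ z) ≐ (R F b z).map (E.extOpl σ f x) := by
  subst p hz
  exact (E.extOpl_same σ rfl (Strict.comp_id x)).trans (R_id_map F _).symm

/-- For chosen `k` this is the definition of the oplax cell; a vertical factor of `k` is absorbed by
`comparison_comp_vertical` applied to `f ≫ h`. -/
lemma extOpl_comparison {b b' d : B} (f : b ⟶ b') (k : b' ⟶ d) :
    Comp (E.extOpl σ f (K.map k)) ((L F f (K.obj d)).map (E.comparison σ k))
      (E.comparison σ (f ≫ k)) := by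
  obtain ⟨c, h, t, hh, p, ht, rfl⟩ := factorization (σ := σ) k
  have h₁ := E.comparison_factorization σ ⟨c, h, t, hh, p, ht, rfl⟩
  refine (E.comparison_comp_vertical σ (f ≫ h) t p ht).congr ?_ ?_
    (E.comparison_same σ (Strict.assoc f h t))
  · refine .trans (.map _ (E.extOpl_map σ f hh).symm) ?_
    exact (E.extOpl_comp_eqToHom σ f _ p ht).symm.trans
      (E.extOpl_same σ rfl (K.map_comp h t).symm)
  · exact (L_comp_map F _ _ _).trans (.map _ h₁.symm)

/-- The lax structure of the extension. -/
noncomputable def extLax {b : B} {a a' : A} (x : K.obj b ⟶ a) (g : a ⟶ a') :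
    (R F b g).obj (E.ext σ x) ⟶ E.ext σ (x ≫ g) :=
  σ.rec₁ (motive := fun {a} x => ∀ (g : a ⟶ a'), (R F b g).obj (E.ext σ x) ⟶ E.ext σ (x ≫ g))
    (fun h hh g => σ.rec₁
      (motive := fun {a'} g => (R F b g).obj (E.ext σ (K.map h)) ⟶ E.ext σ (K.map h ≫ g))
      (fun m hm => eqToHom (by rw [E.ext_map σ hh, L_R_obj]) ≫ (L F h _).map (E.cell m) ≫
        eqToHom (by rw [← K.map_comp, E.ext_map σ (chosen_comp hh hm), L_comp_obj])) g) x g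

lemma extLax_map {b d e : B} {h : b ⟶ d} (hh : σ.Chosen h) {m : d ⟶ e} (hm : σ.Chosen m) :
    E.extLax σ (K.map h) (K.map m) ≐ (L F h (K.obj e)).map (E.cell m) := by
  rw [extLax, rec₁_map _ h hh, rec₁_map _ m hm]
  simpa using .refl

lemma extLax_same {b : B} {a a' : A} {x x' : K.obj b ⟶ a} (hx : x = x') {g g' : a ⟶ a'}
    (hg : g = g') : E.extLax σ x g ≐ E.extLax σ x' g' := by
  subst hx hg
  exact .refl

lemma extLax_eqToHom_comp {b : B} {a a' a'' : A} (x : K.obj b ⟶ a) (p : a = a') {z : a ⟶ a'}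
    (hz : z = eqToHom p) (g : a' ⟶ a'') : E.extLax σ (x ≫ z) g ≐ E.extLax σ x (z ≫ g) := by
  subst p hz
  exact E.extLax_same σ (Strict.comp_id x) (Strict.id_comp g).symm

lemma extLax_comp_eqToHom {b : B} {a a' a'' : A} (x : K.obj b ⟶ a) (g : a ⟶ a') (p : a' = a'')
    {z : a' ⟶ a''} (hz : z = eqToHom p) :
    E.extLax σ x (g ≫ z) ≐ (R F b z).map (E.extLax σ x g) := by
  subst p hz
  exact (E.extLax_same σ rfl (Strict.comp_id g)).trans (R_id_map F _).symm

/-- Both composites are F(h, id) of the extraordinary cell at one 1-cell `t ≫ m = h' ≫ t'`, split by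
the composition axiom in two ways. This square yields the compatibility axiom and, with
`extMap_comparison`, the naturality of the lax cells. -/
lemma extLax_comparison {b d e : B} (k : b ⟶ d) (m : d ⟶ e) :
    Sq (E.extLax σ (K.map k) (K.map m)) (E.comparison σ (k ≫ m))
      ((R F b (K.map m)).map (E.comparison σ k)) ((L F k (K.obj e)).map (E.cell m)) := by
  obtain ⟨c, h, t, hh, p, ht, rfl⟩ := factorization (σ := σ) k
  -- The vertical `t` cannot stay to the left of `m`, since lax cells are defined only on pairs of
  -- composable chosen lifts. Refactoring `t ≫ m` replaces `K m` by `K h'` with `h'` chosen,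
  -- starting at the target of `h`.
  obtain ⟨c', h', t', hh', p', ht', hf⟩ := factorization (σ := σ) (t ≫ m)
  have h₁ := E.comparison_factorization σ ⟨c, h, t, hh, p, ht, rfl⟩
  have e : (h ≫ h') ≫ t' = (h ≫ t) ≫ m := by rw [Strict.assoc, hf, Strict.assoc]
  have h₂ := E.comparison_factorization σ ⟨c', h ≫ h', t', chosen_comp hh hh', p', ht', e⟩
  have h₃ : E.extLax σ (K.map (h ≫ t)) (K.map m) ≐
      (L F h _).map ((R F c (K.map t')).map (E.cell h')) := by
    refine (E.extLax_same σ (K.map_comp h t) rfl).trans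
      ((E.extLax_eqToHom_comp σ (K.map h) p ht (K.map m)).trans ?_)
    refine (E.extLax_same σ rfl (g' := K.map h' ≫ K.map t') ?_).trans ?_
    · rw [← K.map_comp, ← K.map_comp, hf]
    · exact (E.extLax_comp_eqToHom σ _ _ p' ht').trans
        ((Same.map _ (E.extLax_map σ hh hh')).trans (L_R_map F _ _ _))
  have hc : E.cell (h' ≫ t') ≐ E.cell (t ≫ m) := by
    rw [hf]
    exact .refl
  refine Comp.sq (((E.cell_comp h' t').map (L F h _)).congr h₃.symm ?_ .refl)
    (((E.cell_comp t m).map (L F h _)).congr ?_ (L_comp_map F _ _ _).symm (.map _ hc.symm))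
  · exact (L_comp_map F _ _ _).symm.trans h₂.symm
  · exact (L_R_map F _ _ _).symm.trans (.map _ h₁.symm)

/-- The oplax-cart-lax natural transformation extending an extraordinary lax one. -/
noncomputable def toElemTrans : ElemTrans σ F where
  obj := E.ext σ
  map := E.extMap σ
  opl := E.extOpl σ
  lax := E.extLax σ
  map_id {b a} x := by
    refine σ.rec₁ (motive := fun {a} x => E.extMap σ (𝟙 x) = 𝟙 _) ?_ x
    intro d h hh
    refine Same.eq ?_
    rw [← K.map₂_id]
    refine ((E.extMap_map₂ σ hh (𝟙 h)).same_of_right (W := (L F h _).obj (E.obj d)) ?_).symm.trans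
      (E.comparison_chosen σ hh)
    exact .of_eq (L₂_id F h _)
  map_comp {b a x y z} ξ ζ := by
    refine σ.rec₂ (motive := fun {a y z} ζ => ∀ {x : K.obj b ⟶ a} (ξ : x ⟶ y),
      E.extMap σ (ξ ≫ ζ) = E.extMap σ ξ ≫ E.extMap σ ζ) ?_ ζ ξ
    intro d k' k hk δ x ξ
    -- Writing `ζ` as `K δ` makes the codomain of `ξ` equal to `K k'`, where `k'` need not be
    -- chosen; so `ξ` is lifted with prescribed codomain, and `extMap_comparison` is needed for it.
    refine ind₂ σ (motive := fun {x} ξ =>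
      E.extMap σ (ξ ≫ K.map₂ δ) = E.extMap σ ξ ≫ E.extMap σ (K.map₂ δ)) ?_ ξ
    intro k'' δ'
    refine (Comp.eq ?_).symm
    rw [← K.map₂_comp]
    exact (E.extMap_comparison σ δ').comp_right (E.extMap_map₂ σ hk δ) .mk
      ((E.extMap_map₂ σ hk (δ' ≫ δ)).congr .refl (.of_eq (L₂_comp F δ' δ _)) .refl)
  opl_natural {b b'} f {a x y} ξ := by
    refine σ.rec₂ (motive := fun {a x y} ξ => E.extMap σ (K.map f ◁ ξ) ≫ E.extOpl σ f y =
      E.extOpl σ f x ≫ (L F f a).map (E.extMap σ ξ)) ?_ ξ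
    intro d k' k hk δ
    refine Sq.eq (((E.extMap_comparison σ (f ◁ δ)).congr
      (E.extMap_same σ (Same.map₂_whisker_left K f δ)) (E.extOpl_map σ f hk).symm .refl
      (L₂_whiskerLeft F f δ _)).assoc_right (E.extOpl_comparison σ f k')
      ((E.extMap_map₂ σ hk δ).map _))
  opl_map₂ {b b' f f'} δ {a} x := by
    refine σ.rec₁ (motive := fun {a} x => E.extMap σ (K.map₂ δ ▷ x) ≫ E.extOpl σ f' x =
      E.extOpl σ f x ≫ (L₂ F δ a).app (E.ext σ x)) ?_ x
    intro d h hh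
    refine Sq.eq ((E.extMap_comparison σ (δ ▷ h)).congr
      (E.extMap_same σ (Same.map₂_whisker_right K δ h)) (E.extOpl_map σ f' hh).symm
      (E.extOpl_map σ f hh).symm ((L₂_whiskerRight F δ h _).trans (.app _ (E.ext_map σ hh).symm)))
  opl_id {b a} x := by
    refine σ.rec₁ (motive := fun {a} x => E.extOpl σ (𝟙 b) x ≐ 𝟙 (E.ext σ x)) ?_ x
    intro d h hh
    exact (E.extOpl_map σ _ hh).trans ((E.comparison_same σ (Strict.id_comp h)).trans
      (E.comparison_chosen σ hh))
  opl_comp {b b' b''} f f' {a} x := by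
    refine σ.rec₁ (motive := fun {a} x => Comp (E.extOpl σ f (K.map f' ≫ x))
      ((L F f a).map (E.extOpl σ f' x)) (E.extOpl σ (f ≫ f') x)) ?_ x
    intro d h hh
    exact (E.extOpl_comparison σ f (f' ≫ h)).congr (E.extOpl_same σ rfl (K.map_comp f' h))
      (.map _ (E.extOpl_map σ f' hh).symm)
      ((E.comparison_same σ (Strict.assoc f f' h).symm).trans (E.extOpl_map σ _ hh).symm)
  opl_chosen {b b'} f hf {a} x := by
    refine σ.rec₁ (motive := fun {a} x => E.extOpl σ f x ≐ 𝟙 (E.ext σ (K.map f ≫ x))) ?_ x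
    intro d h hh
    -- Closure of the chosen lifts under composition is what makes the oplax cell at a chosen `f`
    -- trivial at every 1-cell, not only at the identity.
    exact (E.extOpl_map σ f hh).trans ((E.comparison_chosen σ (chosen_comp hf hh)).trans
      (.id (by rw [K.map_comp])))
  lax_natural {b a a' x y} ξ g := by
    refine σ.rec₂ (motive := fun {a x y} ξ => ∀ (g : a ⟶ a'), (R F b g).map (E.extMap σ ξ) ≫
      E.extLax σ y g = E.extLax σ x g ≫ E.extMap σ (ξ ▷ g)) ?_ ξ g
    intro d k' k hk δ g
    refine σ.rec₁ (motive := fun {a'} g => (R F b g).map (E.extMap σ (K.map₂ δ)) ≫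
      E.extLax σ (K.map k) g = E.extLax σ (K.map k') g ≫ E.extMap σ (K.map₂ δ ▷ g)) ?_ g
    intro e m hm
    obtain ⟨_, _, n, hn, hn'⟩ := E.extLax_comparison σ k' m
    have h₁ := ((E.extMap_map₂ σ hk δ).map (R F b (K.map m))).congr .refl (L₂_R F δ _ _) .refl
    have h₂ := (Sq.app (L₂ F δ (K.obj e)) (E.cell m)).symm
    have h₃ := (E.extMap_map₂ σ (chosen_comp hk hm) (δ ▷ m)).congr .refl
      (L₂_whiskerRight F δ m _) (E.extMap_same σ (Same.map₂_whisker_right K δ m))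
    exact Sq.eq (((Sq.paste h₁ h₂ hn').congr .refl (E.extLax_map σ hk hm).symm .refl .refl).assoc_right
      hn h₃)
  lax_map₂ {b a a'} x {g g'} γ := by
    refine σ.rec₁ (motive := fun {a} x => ∀ {g g' : a ⟶ a'} (γ : g ⟶ g'), E.extLax σ x g ≫
      E.extMap σ (x ◁ γ) = (R₂ F b γ).app (E.ext σ x) ≫ E.extLax σ x g') ?_ x γ
    intro d h hh g g' γ
    refine σ.rec₂ (motive := fun {a' g g'} γ => E.extLax σ (K.map h) g ≫
      E.extMap σ (K.map h ◁ γ) = (R₂ F b γ).app (E.ext σ (K.map h)) ≫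
        E.extLax σ (K.map h) g') ?_ γ
    intro e m' m hm δ
    obtain ⟨_, _, n, hn, hn'⟩ := E.extLax_comparison σ h m'
    -- Since `h` is chosen, its comparison is an identity, and the square for `h` and `m'`
    -- degenerates to a triangle.
    have h₀ : (L F h (K.obj e)).map (E.cell m') ≐ n := by
      refine hn'.same_of_left (W := (R F b (K.map m')).obj (E.ext σ (K.map h))) ?_
      refine (Same.map _ (E.comparison_chosen σ hh)).trans ?_
      rw [CategoryTheory.Functor.map_id]
      exact .refl
    have h₁ := (E.extMap_map₂ σ (chosen_comp hh hm) (h ◁ δ)).congr .refl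
      (L₂_whiskerLeft F h δ _) (E.extMap_same σ (Same.map₂_whisker_left K h δ))
    have h₂ := (Sq.of_eq (E.cell_map₂ δ)).map (L F h (K.obj e))
    refine (Sq.eq ((h₂.symm.congr ?_ (E.extLax_map σ hh hm).symm h₀ .refl).assoc_right hn h₁)).symm
    exact (R₂_L F h _ _).symm.trans (.app _ (E.ext_map σ hh).symm)
  lax_id {b a} x := by
    refine σ.rec₁ (motive := fun {a} x => E.extLax σ x (𝟙 a) ≐ 𝟙 (E.ext σ x)) ?_ x
    intro d h hh
    refine (E.extLax_same σ rfl (K.map_id d).symm).trans ((E.extLax_map σ hh (chosen_id d)).trans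
      ((Same.map _ (E.cell_id d)).trans ?_))
    rw [CategoryTheory.Functor.map_id]
    exact .id (E.ext_map σ hh).symm
  lax_comp {b a a' a''} x g g' := by
    refine σ.rec₁ (motive := fun {a} x => ∀ (g : a ⟶ a'), Comp ((R F b g').map (E.extLax σ x g))
      (E.extLax σ (x ≫ g) g') (E.extLax σ x (g ≫ g'))) ?_ x g
    intro d h hh g
    refine σ.rec₁ (motive := fun {a'} g => ∀ (g' : a' ⟶ a''), Comp ((R F b g').map
      (E.extLax σ (K.map h) g)) (E.extLax σ (K.map h ≫ g) g')
        (E.extLax σ (K.map h) (g ≫ g'))) ?_ g g'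
    intro e m hm g'
    refine σ.rec₁ (motive := fun {a''} g' => Comp ((R F b g').map
      (E.extLax σ (K.map h) (K.map m))) (E.extLax σ (K.map h ≫ K.map m) g')
        (E.extLax σ (K.map h) (K.map m ≫ g'))) ?_ g'
    intro e' m' hm'
    -- With all three 1-cells lifted, the axiom is the image under F(h, id) of the composition axiom
    -- for `m` and `m'`.
    refine ((E.cell_comp m m').map (L F h (K.obj e'))).congr ?_ ?_ ?_
    · exact (L_R_map F _ _ _).symm.trans (.map _ (E.extLax_map σ hh hm).symm)
    · exact (L_comp_map F _ _ _).symm.trans ((E.extLax_map σ (chosen_comp hh hm) hm').symm.trans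
        (E.extLax_same σ (K.map_comp h m) rfl))
    · exact (E.extLax_map σ hh (chosen_comp hm hm')).symm.trans
        (E.extLax_same σ rfl (K.map_comp m m'))
  compat {b b'} f {a a'} x g := by
    refine σ.rec₁ (motive := fun {a} x => ∀ (g : a ⟶ a'), Sq (E.extLax σ (K.map f ≫ x) g)
      (E.extOpl σ f (x ≫ g)) ((R F b g).map (E.extOpl σ f x))
        ((L F f a').map (E.extLax σ x g))) ?_ x g
    intro d h hh g
    refine σ.rec₁ (motive := fun {a'} g => Sq (E.extLax σ (K.map f ≫ K.map h) g)
      (E.extOpl σ f (K.map h ≫ g)) ((R F b g).map (E.extOpl σ f (K.map h)))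
        ((L F f a').map (E.extLax σ (K.map h) g))) ?_ g
    intro e m hm
    refine (E.extLax_comparison σ (f ≫ h) m).congr (E.extLax_same σ (K.map_comp f h) rfl) ?_
      (.map _ (E.extOpl_map σ f hh).symm) ?_
    · exact (E.comparison_same σ (Strict.assoc f h m)).trans
        ((E.extOpl_map σ f (chosen_comp hh hm)).symm.trans
          (E.extOpl_same σ rfl (K.map_comp h m)))
    · exact (L_comp_map F _ _ _).trans (.map _ (E.extLax_map σ hh hm).symm)

lemma toElemTrans_pt (b : B) : (E.toElemTrans σ).pt b = E.obj b := by
  change E.ext σ (𝟙 (K.obj b)) = _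
  rw [← K.map_id, E.ext_map σ (chosen_id b), L_id_obj]

/-- The square `extLax_comparison` at `k = 𝟙 b`, where the comparison is an identity, says that the
lax and oplax cells at identities compose to the given cell. -/
lemma toElemTrans_arrow {b b' : B} (f : b ⟶ b') : (E.toElemTrans σ).arrow f ≐ E.cell f := by
  refine ((E.toElemTrans σ).arrow_comp f).same ?_
  obtain ⟨_, _, n, hn, hn'⟩ := E.extLax_comparison σ (𝟙 b) f
  have h₀ : (L F (𝟙 b) (K.obj b')).map (E.cell f) ≐ n := by
    refine hn'.same_of_left (W := (R F b (K.map f)).obj (E.ext σ (K.map (𝟙 b)))) ?_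
    refine (Same.map _ (E.comparison_chosen σ (chosen_id b))).trans ?_
    rw [CategoryTheory.Functor.map_id]
    exact .refl
  refine hn.congr (E.extLax_same σ (K.map_id b) rfl) ?_ (h₀.symm.trans (L_id_map F _))
  exact (E.comparison_same σ ((Strict.id_comp f).trans (Strict.comp_id f).symm)).trans
    ((E.extOpl_map σ f (chosen_id b')).symm.trans (E.extOpl_same σ rfl (K.map_id b')))

end ElemExtra

end Extension

end OplaxCartLax

namespace OplaxCartLax

open SplitDiscreteTwoOpfibration

/-! ### Rigidity: modifications, and evaluation as a bijective-on-objects, fully faithful functor.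
-/

section Modifications

variable {A : Type u} [Bicategory.{w, v} A] [Strict A]
  {B : Type u₁} [Bicategory.{w₁, v₁} B] [Strict B]
  {K : StrictPseudofunctor B A} {σ : SplitDiscreteTwoOpfibration K}
  {F : StrictPseudofunctor (Bᵒᵖ × A) Cat.{w, v}}

namespace ElemTrans

section

variable (S : ElemTrans σ F)

lemma opl_id_chosen {b d : B} {h : b ⟶ d} (hh : σ.Chosen h) :
    S.opl h (𝟙 _) ≐ 𝟙 (S.obj (K.map h)) :=
  (S.opl_chosen h hh _).trans (.id (congrArg S.obj (Strict.comp_id _)))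

lemma obj_map {b d : B} {h : b ⟶ d} (hh : σ.Chosen h) :
    S.obj (K.map h) = (L F h (K.obj d)).obj (S.pt d) :=
  (S.opl_id_chosen hh).target.symm

/-- Naturality of the oplax cells in `δ`, where the cell at the chosen `k` drops out. Thus the
action on 2-cells is forced by the oplax cells at identities. -/
lemma map_map₂ {b d : B} {k' k : b ⟶ d} (hk : σ.Chosen k) (δ : k' ⟶ k) :
    Comp (S.opl k' (𝟙 _)) ((L₂ F δ (K.obj d)).app (S.pt d)) (S.map (K.map₂ δ)) := by
  have h₁ := Sq.of_eq (S.opl_map₂ δ (𝟙 (K.obj d)))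
  obtain ⟨_, _, n, hn, hn'⟩ := h₁
  exact hn'.congr .refl .refl ((hn.same_of_right (S.opl_id_chosen hk)).symm.trans
    (S.map_same (.whisker_right_id _)))

/-- For vertical `t` the lax half of the evaluation is an identity, so only the oplax half remains.
-/
lemma arrow_vertical {d e : B} (t : d ⟶ e) (p : K.obj d = K.obj e) (ht : K.map t = eqToHom p) :
    S.opl t (𝟙 _) ≐ S.arrow t := by
  have key : ∀ {a : A} (p : K.obj d = a) (z : K.obj d ⟶ a), z = eqToHom p →
      S.lax (𝟙 _) z ≐ 𝟙 ((R F d z).obj (S.pt d)) := by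
    rintro _ rfl _ rfl
    exact (S.lax_id _).trans (.id (R_id_obj F _).symm)
  exact (S.arrow_comp t).same_of_left (key p _ ht)

lemma opl_factorization {b d e : B} {h : b ⟶ d} (hh : σ.Chosen h) (t : d ⟶ e)
    (p : K.obj d = K.obj e) (ht : K.map t = eqToHom p) :
    S.opl (h ≫ t) (𝟙 _) ≐ (L F h (K.obj e)).map (S.arrow t) :=
  ((S.opl_comp h t (𝟙 _)).same_of_left (S.opl_chosen h hh _)).symm.trans
    (.map _ (S.arrow_vertical t p ht))

lemma opl_comp_chosen {b b' d : B} (f : b ⟶ b') {h : b' ⟶ d} (hh : σ.Chosen h) :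
    S.opl (f ≫ h) (𝟙 _) ≐ S.opl f (K.map h) := by
  refine ((S.opl_comp f h (𝟙 _)).same_of_right (W := (L F f _).obj (S.obj (K.map h))) ?_).symm.trans
    (S.opl_same rfl (Strict.comp_id _))
  refine (Same.map _ (S.opl_id_chosen hh)).trans ?_
  rw [CategoryTheory.Functor.map_id]
  exact .refl

/-- Compatibility at the identity, with the oplax cells of the chosen `h` cancelled, reduces the lax
cell to F(h, id) of the one at the identity; since `m` is chosen, the latter is the whole evaluation
at `m`. -/
lemma lax_map {b d e : B} {h : b ⟶ d} (hh : σ.Chosen h) {m : d ⟶ e} (hm : σ.Chosen m) :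
    S.lax (K.map h) (K.map m) ≐ (L F h (K.obj e)).map (S.arrow m) := by
  obtain ⟨_, _, n, hn, hn'⟩ := S.compat h (𝟙 (K.obj d)) (K.map m)
  have h₁ : (L F h (K.obj e)).map (S.lax (𝟙 _) (K.map m)) ≐ n := by
    refine hn'.same_of_left (W := (R F b (K.map m)).obj (S.obj (K.map h))) ?_
    refine (Same.map _ (S.opl_id_chosen hh)).trans ?_
    rw [CategoryTheory.Functor.map_id]
    exact .refl
  refine (S.lax_same (Strict.comp_id _).symm rfl).trans
    ((hn.same_of_right (S.opl_chosen h hh _)).trans (h₁.symm.trans (.map _ ?_)))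
  exact (S.arrow_comp m).same_of_right (S.opl_id_chosen hm)

end

/-- Modifications between oplax-cart-lax natural transformations, elementwise. -/
structure Modification (S T : ElemTrans σ F) where
  app {b : B} {a : A} (x : K.obj b ⟶ a) : S.obj x ⟶ T.obj x
  natural {b : B} {a : A} {x y : K.obj b ⟶ a} (ξ : x ⟶ y) : S.map ξ ≫ app y = app x ≫ T.map ξ
  oplax {b b' : B} (f : b ⟶ b') {a : A} (x : K.obj b' ⟶ a) :
    app (K.map f ≫ x) ≫ T.opl f x = S.opl f x ≫ (L F f a).map (app x)
  lax {b : B} {a a' : A} (x : K.obj b ⟶ a) (g : a ⟶ a') :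
    (R F b g).map (app x) ≫ T.lax x g = S.lax x g ≫ app (x ≫ g)

namespace Modification

variable {S T : ElemTrans σ F}

lemma app_same (Θ : Modification S T) {b : B} {a : A} {x y : K.obj b ⟶ a} (h : x = y) :
    Θ.app x ≐ Θ.app y := by
  subst h
  exact .refl

/-- The oplax axiom at a chosen lift, where both structure cells are identities. It is the reason
why a modification is determined by its values at identities. -/
lemma app_map (Θ : Modification S T) {b d : B} {h : b ⟶ d} (hh : σ.Chosen h) :
    Θ.app (K.map h) ≐ (L F h (K.obj d)).map (Θ.app (𝟙 _)) := by
  obtain ⟨_, _, n, hn, hn'⟩ := Sq.of_eq (Θ.oplax h (𝟙 (K.obj d)))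
  exact (Θ.app_same (Strict.comp_id _).symm).trans
    ((hn.same_of_right (T.opl_id_chosen hh)).trans (hn'.same_of_left (S.opl_id_chosen hh)).symm)

lemma app_eq {Θ Ω : Modification S T} (h : ∀ b, Θ.app (𝟙 (K.obj b)) = Ω.app (𝟙 _)) {b : B} {a : A}
    (x : K.obj b ⟶ a) : Θ.app x = Ω.app x := by
  refine σ.rec₁ (motive := fun {a} x => Θ.app x = Ω.app x) ?_ x
  intro d k hk
  exact ((Θ.app_map hk).trans ((Same.of_eq (congrArg _ (h d))).trans (Ω.app_map hk).symm)).eq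

lemma app_eq_id {Θ : Modification S T} (h : ∀ b, Θ.app (𝟙 (K.obj b)) ≐ 𝟙 (S.pt b)) {b : B} {a : A}
    (x : K.obj b ⟶ a) : Θ.app x ≐ 𝟙 (S.obj x) := by
  refine σ.rec₁ (motive := fun {a} x => Θ.app x ≐ 𝟙 (S.obj x)) ?_ x
  intro d k hk
  refine (Θ.app_map hk).trans ((Same.map _ (h d)).trans ?_)
  rw [CategoryTheory.Functor.map_id]
  exact .id (S.obj_map hk).symm

/-- The evaluation of a modification at identities is a modification. -/
lemma eval_naturality (Θ : Modification S T) {b b' : B} (f : b ⟶ b') :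
    (R F b (K.map f)).map (Θ.app (𝟙 (K.obj b))) ≫ T.arrow f =
      S.arrow f ≫ (L F f (K.obj b')).map (Θ.app (𝟙 (K.obj b'))) := by
  obtain ⟨_, _, n, hn, hn'⟩ := Sq.of_eq (Θ.lax (𝟙 (K.obj b)) (K.map f))
  have h := Sq.of_eq (Θ.oplax f (𝟙 (K.obj b')))
  have e := Θ.app_same ((Strict.id_comp (K.map f)).trans (Strict.comp_id _).symm)
  exact ((Sq.paste (hn'.congr .refl e .refl) h (S.arrow_comp f)).symm.assoc_right hn
    (T.arrow_comp f)).eq.symm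

end Modification

section Extension

variable {S T : ElemTrans σ F} (γ : ∀ b, S.pt b ⟶ T.pt b)

/-- The extension of a family of morphisms between the values at identities. -/
noncomputable def extApp {b : B} {a : A} (x : K.obj b ⟶ a) : S.obj x ⟶ T.obj x :=
  σ.rec₁ (motive := fun {_} x => S.obj x ⟶ T.obj x)
    (fun {d} _ hh => eqToHom (S.obj_map hh) ≫ (L F _ _).map (γ d) ≫ eqToHom (T.obj_map hh).symm) x

lemma extApp_map {b d : B} {h : b ⟶ d} (hh : σ.Chosen h) :
    extApp γ (K.map h) ≐ (L F h (K.obj d)).map (γ d) := by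
  rw [extApp, rec₁_map _ h hh]
  simpa using .refl

lemma extApp_same {b : B} {a : A} {x y : K.obj b ⟶ a} (h : x = y) :
    extApp γ x ≐ extApp γ y := by
  subst h
  exact .refl

lemma extApp_id (b : B) : extApp γ (𝟙 (K.obj b)) = γ b :=
  ((extApp_same γ (K.map_id b).symm).trans ((extApp_map γ (chosen_id b)).trans (L_id_map F _))).eq

lemma extApp_comp_eqToHom {b : B} {a a' : A} (x : K.obj b ⟶ a) (p : a = a') {z : a ⟶ a'}
    (hz : z = eqToHom p) : extApp γ (x ≫ z) ≐ (R F b z).map (extApp γ x) := by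
  subst p hz
  exact (extApp_same γ (Strict.comp_id x)).trans (R_id_map F _).symm

/-- On the vertical part of `k` the oplax cells are evaluations, so the square is F(h, id) applied
to the hypothesis at `t`. -/
lemma extApp_opl (hγ : ∀ {b b' : B} (f : b ⟶ b'),
      (R F b (K.map f)).map (γ b) ≫ T.arrow f = S.arrow f ≫ (L F f (K.obj b')).map (γ b'))
    {b e : B} (k : b ⟶ e) :
    Sq (extApp γ (K.map k)) (T.opl k (𝟙 _)) (S.opl k (𝟙 _)) ((L F k (K.obj e)).map (γ e)) := by
  obtain ⟨d, h, t, hh, p, ht, rfl⟩ := factorization (σ := σ) k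
  refine ((Sq.of_eq (hγ t)).map (L F h (K.obj e))).congr ?_ (T.opl_factorization hh t p ht).symm
    (S.opl_factorization hh t p ht).symm (L_comp_map F h t _).symm
  refine (L_R_map F _ _ _).symm.trans ((Same.map _ (extApp_map γ hh).symm).trans ?_)
  exact (extApp_comp_eqToHom γ _ p ht).symm.trans (extApp_same γ (K.map_comp h t).symm)

/-- The extension of a modification between the values at identities. -/
noncomputable def extMod (hγ : ∀ {b b' : B} (f : b ⟶ b'),
      (R F b (K.map f)).map (γ b) ≫ T.arrow f = S.arrow f ≫ (L F f (K.obj b')).map (γ b')) :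
    Modification S T where
  app := extApp γ
  natural {b a x y} ξ := by
    refine σ.rec₂ (motive := fun {a x y} ξ => S.map ξ ≫ extApp γ y = extApp γ x ≫ T.map ξ) ?_ ξ
    intro d k' k hk δ
    obtain ⟨_, _, n, hn, hn'⟩ := extApp_opl γ hγ k'
    have h := Sq.paste (S.map_map₂ hk δ) (Sq.app (L₂ F δ (K.obj d)) (γ d)).symm hn'
    exact ((h.congr .refl (extApp_map γ hk).symm .refl .refl).assoc_right hn (T.map_map₂ hk δ)).eq
  oplax {b b'} f {a} x := by
    refine σ.rec₁ (motive := fun {a} x => extApp γ (K.map f ≫ x) ≫ T.opl f x =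
      S.opl f x ≫ (L F f a).map (extApp γ x)) ?_ x
    intro d h hh
    exact ((extApp_opl γ hγ (f ≫ h)).congr (extApp_same γ (K.map_comp f h))
      (T.opl_comp_chosen f hh) (S.opl_comp_chosen f hh)
      ((L_comp_map F _ _ _).trans (.map _ (extApp_map γ hh).symm))).eq
  lax {b a a'} x g := by
    refine σ.rec₁ (motive := fun {a} x => ∀ (g : a ⟶ a'), (R F b g).map (extApp γ x) ≫ T.lax x g =
      S.lax x g ≫ extApp γ (x ≫ g)) ?_ x g
    intro d h hh g
    refine σ.rec₁ (motive := fun {a'} g => (R F b g).map (extApp γ (K.map h)) ≫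
      T.lax (K.map h) g = S.lax (K.map h) g ≫ extApp γ (K.map h ≫ g)) ?_ g
    intro e m hm
    refine (((Sq.of_eq (hγ m)).map (L F h (K.obj e))).congr ?_ (T.lax_map hh hm).symm
      (S.lax_map hh hm).symm ?_).eq
    · exact (L_R_map F _ _ _).symm.trans (.map _ (extApp_map γ hh).symm)
    · exact (L_comp_map F _ _ _).symm.trans ((extApp_map γ (chosen_comp hh hm)).symm.trans
        (extApp_same γ (K.map_comp h m)))

end Extension

end ElemTrans

namespace OplaxCartLaxTrans

variable {α β : OplaxCartLaxTrans σ (homTwoFunctor K) F}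

/-- The elementwise data of a modification. -/
def toElemMod (Θ : α ⟶ β) : ElemTrans.Modification α.toElem β.toElem where
  app {b a} x := (Modification.app Θ b a).toNatTrans.app x
  natural {b a x y} ξ := (Modification.app Θ b a).toNatTrans.naturality ξ
  oplax {b b'} f {a} x := by
    have h := Sq.of_eq (hom₂_ext_iff.1 (Modification.oplax Θ f a) x)
    refine (h.congr ?_ (β.opl_same f rfl) (α.opl_same f rfl) .refl).eq
    exact .app (C := K.obj b ⟶ a) (Modification.app Θ b a).toNatTrans (hom_L_obj K f x)
  lax {b a a'} x g := by
    have h := Sq.of_eq (hom₂_ext_iff.1 (Modification.lax Θ b g) x)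
    refine (h.congr .refl (β.lax_same g rfl) (α.lax_same g rfl) ?_).eq
    exact .app (C := K.obj b ⟶ a') (Modification.app Θ b a').toNatTrans (hom_R_obj K g x)

/-- The modification given by elementwise data. -/
def ofElemMod (Θ : ElemTrans.Modification α.toElem β.toElem) : α ⟶ β :=
  show Modification α β from
  { app := fun b a => Cat.Hom₂.ofNatTrans
      { app := fun x : K.obj b ⟶ a => Θ.app x
        naturality := fun (x y : K.obj b ⟶ a) ξ => Θ.natural ξ }
    oplax := fun {b b'} f a => hom₂_ext_iff.2 fun (x : K.obj b' ⟶ a) => by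
      refine ((Sq.of_eq (Θ.oplax f x)).congr ?_ (β.opl_same f rfl).symm (α.opl_same f rfl).symm
        .refl).eq
      exact Θ.app_same (hom_L_obj K f x).symm
    lax := fun b {a a'} g => hom₂_ext_iff.2 fun (x : K.obj b ⟶ a) => by
      refine ((Sq.of_eq (Θ.lax x g)).congr .refl (β.lax_same g rfl).symm (α.lax_same g rfl).symm
        ?_).eq
      exact Θ.app_same (hom_R_obj K g x).symm }

/-- The modification axioms with identity components say exactly that the structure cells coincide.
-/
lemma eq_of_modification (Θ : α ⟶ β)
    (h : ∀ b a, ∃ e, Modification.app Θ b a = eqToHom e) : α = β := by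
  obtain ⟨p, o, l, _, _, _, _, _, _, _, _⟩ := α
  obtain ⟨p', o', l', _, _, _, _, _, _, _, _⟩ := β
  obtain rfl : p = p' := funext fun b => funext fun a => (h b a).1
  have h₀ : ∀ b a, Modification.app Θ b a = 𝟙 (p b a) := fun b a => (h b a).2
  have h₁ : @o = @o' := by
    funext b b' f a
    have := Modification.oplax Θ f a
    rw [h₀, h₀] at this
    simpa using this.symm
  have h₂ : @l = @l' := by
    funext b a a' g
    have := Modification.lax Θ b g
    rw [h₀, h₀] at this
    simpa using this.symm
  subst h₁ h₂
  rfl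

end OplaxCartLaxTrans

namespace ExtraordinaryLaxTrans

lemma ext_elem {η θ : ExtraordinaryLaxTrans K Cat.chosenTerminal.{w, v} F}
    (h : ∀ b, η.pt b = θ.pt b) (h' : ∀ {b b' : B} (f : b ⟶ b'), η.arrow f ≐ θ.arrow f) :
    η = θ := by
  obtain ⟨⟨p, c⟩, _, _, _⟩ := η
  obtain ⟨⟨p', c'⟩, _, _, _⟩ := θ
  obtain rfl : p = p' := funext fun b => hom_star_ext (h b)
  obtain rfl : @c = @c' := by
    funext b b' f
    exact hom₂_star_ext_iff.2 (h' f).eq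
  rfl

lemma arrow_same {η θ : ExtraordinaryLaxTrans K Cat.chosenTerminal.{w, v} F} (h : η = θ)
    {b b' : B} (f : b ⟶ b') : η.arrow f ≐ θ.arrow f := by
  subst h
  exact .refl

end ExtraordinaryLaxTrans

variable (σ F) in
/-- Evaluation at identities. -/
def evalFunctor : OplaxCartLaxTrans σ (homTwoFunctor K) F ⥤
    ExtraordinaryLaxTrans K Cat.chosenTerminal.{w, v} F where
  obj := evalTrans
  map {α β} Θ := show ExtraordinaryLaxTrans.Modification _ _ from
    { app := fun b => pickId K b ◁ OplaxCartLaxTrans.Modification.app Θ b (K.obj b)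
      naturality := fun {b b'} f => hom₂_star_ext_iff.2 (by
        have h := (OplaxCartLaxTrans.toElemMod Θ).eval_naturality f
        rw [← evalId_arrow, ← evalId_arrow] at h
        exact h) }
  map_id α := by
    refine ExtraordinaryLaxTrans.Modification.ext (funext fun b => ?_)
    exact whiskerLeft_id _ _
  map_comp Θ Ω := by
    refine ExtraordinaryLaxTrans.Modification.ext (funext fun b => ?_)
    exact whiskerLeft_comp _ _ _

instance : (evalFunctor σ F).Faithful where
  map_injective {α β Θ Ω} h := by
    refine OplaxCartLaxTrans.Modification.ext (funext fun b => funext fun a => ?_)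
    refine hom₂_ext_iff.2 fun x => ElemTrans.Modification.app_eq
      (Θ := OplaxCartLaxTrans.toElemMod Θ) (Ω := OplaxCartLaxTrans.toElemMod Ω) (fun d => ?_) x
    exact hom₂_star_ext_iff.1
      (congrFun (congrArg ExtraordinaryLaxTrans.Modification.app h) d)

instance : (evalFunctor σ F).Full where
  map_surjective {α β} Γ := by
    let γ : ∀ b, α.toElem.pt b ⟶ β.toElem.pt b := fun b =>
      (ExtraordinaryLaxTrans.Modification.app Γ b).toNatTrans.app star
    refine ⟨OplaxCartLaxTrans.ofElemMod (ElemTrans.extMod γ fun {b b'} f => ?_), ?_⟩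
    · rw [← evalId_arrow, ← evalId_arrow]
      exact hom₂_star_ext_iff.1 (ExtraordinaryLaxTrans.Modification.naturality Γ f)
    · refine ExtraordinaryLaxTrans.Modification.ext (funext fun b => ?_)
      exact hom₂_star_ext_iff.2 (ElemTrans.extApp_id γ b)

/-- Equal evaluations make the canonical transports at identities compatible with the cells. Their
extension is a modification whose components are all identities, which forces α = β. -/
lemma evalFunctor_obj_injective : Function.Injective (evalFunctor σ F).obj := by
  intro α β h
  have hp : ∀ b, α.toElem.pt b = β.toElem.pt b := fun b =>
    congrArg (fun η : ExtraordinaryLaxTrans K Cat.chosenTerminal.{w, v} F => η.pt b) h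
  have ha : ∀ {b b' : B} (f : b ⟶ b'), α.toElem.arrow f ≐ β.toElem.arrow f := by
    intro b b' f
    rw [← evalId_arrow, ← evalId_arrow]
    exact ExtraordinaryLaxTrans.arrow_same h f
  let Θ := ElemTrans.extMod (fun b => eqToHom (hp b)) fun {b b'} f => by
    refine Same.eq ?_
    simpa [eqToHom_map] using (ha f).symm
  refine OplaxCartLaxTrans.eq_of_modification (OplaxCartLaxTrans.ofElemMod Θ) fun b a => ?_
  refine exists_eq_eqToHom_iff.2 fun x => ElemTrans.Modification.app_eq_id (Θ := Θ) (fun d => ?_) x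
  exact (Same.of_eq (ElemTrans.extApp_id _ d)).trans ((Same.eqToHom_iff _ _).2 .refl)

lemma toTrans_toElem_arrow (T : ElemTrans σ F) {b b' : B} (f : b ⟶ b') :
    T.toTrans.toElem.arrow f ≐ T.arrow f := by
  refine (T.toTrans.toElem.arrow_comp f).same ((T.arrow_comp f).congr ?_ ?_ .refl)
  · exact (T.laxCell_app _ _ _ _ rfl).symm.trans (T.toTrans.lax_same (K.map f) rfl)
  · exact (T.oplaxCell_app _ _ _ _ rfl).symm.trans (T.toTrans.opl_same f rfl)

lemma evalFunctor_obj_surjective : Function.Surjective (evalFunctor σ F).obj := by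
  intro η
  refine ⟨(η.toElem.toElemTrans σ).toTrans, ExtraordinaryLaxTrans.ext_elem (fun b => ?_)
    fun f => ?_⟩
  · exact η.toElem.toElemTrans_pt σ b
  · exact (Same.of_eq (evalId_arrow _ f)).trans
      ((toTrans_toElem_arrow _ f).trans (η.toElem.toElemTrans_arrow σ f))

end Modifications

/-- A fully faithful functor that is bijective on objects is an isomorphism of categories. -/
lemma exists_inverse_functor {C : Type u₁} [Category.{v₁} C] {D : Type u₂} [Category.{v₂} D]
    (Φ : C ⥤ D) [Φ.Full] [Φ.Faithful] (h : Function.Bijective Φ.obj) :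
    ∃ Ψ : D ⥤ C, Φ ⋙ Ψ = 𝟭 C ∧ Ψ ⋙ Φ = 𝟭 D := by
  let e := Equiv.ofBijective Φ.obj h
  have he : ∀ d, Φ.obj (e.symm d) = d := e.apply_symm_apply
  let Ψ : D ⥤ C :=
    { obj := e.symm
      map := fun {d d'} f => Φ.preimage (eqToHom (he d) ≫ f ≫ eqToHom (he d').symm)
      map_id := fun d => Φ.map_injective (by simp)
      map_comp := fun f g => Φ.map_injective (by simp) }
  refine ⟨Ψ, ?_, ?_⟩
  · refine CategoryTheory.Functor.ext (fun c => e.symm_apply_apply c) fun c c' f => ?_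
    refine Φ.map_injective
      (Same.eq ((Same.of_eq (Φ.map_preimage _)).trans (.trans ?_ (.map Φ (f := f) ?_))))
    · exact (Same.eqToHom_comp_iff _ _ _).2 ((Same.comp_eqToHom_iff _ _ _).2 .refl)
    · exact (Same.iff_eqToHom_comp _ _ _).2 ((Same.iff_comp_eqToHom _ _ _).2 .refl)
  · refine CategoryTheory.Functor.ext he fun d d' f => ?_
    simp [Ψ]

end OplaxCartLax

theorem mainTheorem4 {A : Type u} [Bicategory.{w, v} A] [Strict A]
    {B : Type u₁} [Bicategory.{w₁, v₁} B] [Strict B]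
    (K : StrictPseudofunctor B A) (σ : OplaxCartLax.SplitDiscreteTwoOpfibration K)
    (F : StrictPseudofunctor (Bᵒᵖ × A) Cat.{w, v}) :
    ∃ (Φ : OplaxCartLax.OplaxCartLaxTrans σ (OplaxCartLax.homTwoFunctor K) F ⥤
          OplaxCartLax.ExtraordinaryLaxTrans K Cat.chosenTerminal.{w, v} F)
      (Ψ : OplaxCartLax.ExtraordinaryLaxTrans K Cat.chosenTerminal.{w, v} F ⥤
          OplaxCartLax.OplaxCartLaxTrans σ (OplaxCartLax.homTwoFunctor K) F),
      Φ ⋙ Ψ = 𝟭 _ ∧ Ψ ⋙ Φ = 𝟭 _ ∧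
      (∀ α, (Φ.obj α).toExtraordinaryLaxData = OplaxCartLax.evalId α) ∧
      (∀ {α β} (Θ : α ⟶ β) (b : B),
        HEq ((Φ.map Θ).app b) (OplaxCartLax.pickId K b ◁ Θ.app b (K.obj b))) := by
  obtain ⟨Ψ, h, h'⟩ := OplaxCartLax.exists_inverse_functor (OplaxCartLax.evalFunctor σ F)
    ⟨OplaxCartLax.evalFunctor_obj_injective, OplaxCartLax.evalFunctor_obj_surjective⟩
  -- Evaluation was built from `evalId` and whiskering with `pickId`, so both explicit descriptions
  -- hold by definition.
  exact ⟨OplaxCartLax.evalFunctor σ F, Ψ, h, h', fun _ => rfl, fun _ _ => .rfl⟩
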